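/- Let $0<\alpha<1/3$, $p_1=(0,0)$, $p_2=(\tfrac12,\tfrac{\sqrt3}{2})$, $p_3=(1,0)$, $p_4=\tfrac{p_2+p_3}2$, $p_5=\tfrac{p_1+p_3}2$, $p_6=\tfrac{p_1+p_2}2$. For $i=1,\dots,6$ put $G_i(x)=A_i(x-p_i)+p_i$, where $A_1=A_2=A_3=\tfrac{1-\alpha}{2}I_2$ and $A_4,A_5,A_6$ are $\alpha$ times the orthogonal projections of $\mathbb R^2$ onto the directions of the sides $p_2p_3$, $p_1p_3$, $p_1p_2$ respectively. Let $K_\alpha\subset\mathbb R^2$ (the Hanoi attractor) be the unique nonempty compact set with $K_\alpha=\bigcup_{i=1}^6G_i(K_\alpha)$. For a word $w=w_1\cdots w_n$ over $\mathcal A=\{1,2,3\}$ put $G_w=G_{w_1}\circ\cdots\circ G_{w_n}$ ($G_\emptyset=\mathrm{id}$). For $\{i,j,k\}=\mathcal A$ let $e_i$ be the open segment joining $G_j(p_k)$ and $G_k(p_j)$. For $n\ge0$ set $$W_n=\bigcup_{w\in\mathcal A^n}G_w(\{p_1,p_2,p_3\}),\qquad J_n=\bigcup_{m=0}^{n-1}\bigcup_{w\in\mathcal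 A^m}G_w(e_1\cup e_2\cup e_3),\qquad V_n=W_n\cup J_n,\qquad V_*=\bigcup_{n\ge0}V_n,$$ and let $\mathcal J_n$ be the set of connected components of $J_n$, i.e. the segments $e=G_w(e_i)$ with $|w|<n$. For $e\in\mathcal J_n$ with endpoints $a_e,b_e$ let $\varphi_e(t)=a_e+t(b_e-a_e)$, $t\in[0,1]$. Let $\mathcal D_n$ be the space of all $u\colon V_n\to\mathbb R$ such that for every $e\in\mathcal J_n$ the function $u\circ\varphi_e$ on the closed interval $[0,1]$ is the continuous representative of an element of $H^1(0,1)$, i.e. is absolutely continuous with square-integrable derivative. Put $d_n=\alpha\big(\tfrac{1-\alpha}2\big)^{n-1}$, $r_n^d=\tfrac{3}{5+3d_n}$, $r_n^c=\tfrac{3d_n}{5+3d_n}$ for $n\ge1$, $\rho_0^d=1$, $\rho_n^d=\prod_{i=1}^nr_i^d$, $\rho_n^c=\rho_{n-1}^d\,r_n^c$, and for $u\in\mathcal D_n$ $$\mathcal E_n[u]=\frac1{\rho_n^d}\sum_{w\in\mathcal A^n}\ \sum_{1\le i<j\le3}\big(u(G_wp_i)-u(G_wp_j)\big)^2+\sum_{k=1}^n\frac1{\rho_k^c}\sum_{e\in\mathcal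 J_k\setminus\mathcal J_{k-1}}\int_0^1|(u\circ\varphi_e)'(t)|^2\,dt .$$ Let $\mathcal D_*$ be the set of all $u\colon V_*\to\mathbb R$ with $u|_{V_n}\in\mathcal D_n$ for all $n$ for which $\lim_{n\to\infty}\mathcal E_n[u|_{V_n}]$ exists and is finite. A resistance form on a set $X$ is a pair $(E,F)$ such that: (R1) $F$ is a linear space of functions $X\to\mathbb R$ containing the constants, and $E$ is a nonnegative symmetric bilinear form on $F$ with $E(u,u)=0$ if and only if $u$ is constant; (R2) $F$ modulo constants is complete for the metric $E(u-v,u-v)^{1/2}$; (R3) for any two distinct points $x,y\in X$ there is $u\in F$ with $u(x)\ne u(y)$; (R4) $\sup\{|u(x)-u(y)|^2/E(u,u) : u\in F,\ E(u,u)>0\}<\infty$ for all $x,y\in X$; (R5) if $u\in F$ then $\bar u=\min(\max(u,0),1)\in F$ and $E(\bar u,\bar u)\le E(u,u)$. **Theorem.** $V_*$ is a dense subset of $K_\alpha$. If $u\colon V_*\to\mathbb R$ satisfies $u|_{V_n}\in\mathcal D_n$ for all $n$, then $\mathcal E_n[u|_{V_n}]$ is nondecreasing in $n$. Every $u\in\mathcal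 D_*$ has a continuous extension to $K_\alpha$ (necessarily unique), given by limits along $V_*$. Let $\mathcal F$ be the set of these extensions, and for $u\in\mathcal F$ let $\mathcal E[u]=\lim_{n\to\infty}\mathcal E_n[u|_{V_n}]$ and $\mathcal E(u,v)=\tfrac12(\mathcal E[u+v]-\mathcal E[u]-\mathcal E[v])$. Then the limit exists, $\mathcal E(u,u)=\mathcal E[u]$, and $(\mathcal E,\mathcal F)$ is a resistance form on $K_\alpha$. Moreover $\mathcal F\subset C(K_\alpha)$, and $\mathcal F$ consists exactly of the continuous functions $u\colon K_\alpha\to\mathbb R$ with $u|_{V_n}\in\mathcal D_n$ for all $n$ and $\sup_n\mathcal E_n[u|_{V_n}]<\infty$. -/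

import Mathlib

open Set Filter Topology MeasureTheory

noncomputable section

namespace Hanoi

/-- The Euclidean plane. -/
abbrev Plane : Type := EuclideanSpace ℝ (Fin 2)

/-! ### The contractions and the attractor -/

/-- The points `p₁, …, p₆` (indices shifted by one): the vertices of an equilateral triangle of
side length one, followed by the midpoints of its sides. -/
def p : Fin 6 → Plane
  | 0 => !₂[0, 0]
  | 1 => !₂[1 / 2, √3 / 2]
  | 2 => !₂[1, 0]
  | 3 => !₂[3 / 4, √3 / 4]
  | 4 => !₂[1 / 2, 0]
  | 5 => !₂[1 / 4, √3 / 4]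

/-- The linear parts `A₁, …, A₆` (indices shifted by one). -/
def A (α : ℝ) : Fin 6 → Matrix (Fin 2) (Fin 2) ℝ
  | 0 => ((1 - α) / 2) • (1 : Matrix (Fin 2) (Fin 2) ℝ)
  | 1 => ((1 - α) / 2) • (1 : Matrix (Fin 2) (Fin 2) ℝ)
  | 2 => ((1 - α) / 2) • (1 : Matrix (Fin 2) (Fin 2) ℝ)
  | 3 => (α / 4) • !![1, -√3; -√3, 3]
  | 4 => α • !![1, 0; 0, 0]
  | 5 => (α / 4) • !![1, √3; √3, 3]

/-- The contractions `G_{α,i}(x) = A_i (x - p_i) + p_i`. -/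
def G (α : ℝ) (i : Fin 6) (x : Plane) : Plane :=
  WithLp.toLp 2 ((A α i).mulVec (WithLp.ofLp (x - p i))) + p i

theorem norm_mulVec_A_le (α : ℝ) (hα : α ∈ Ioo (0 : ℝ) (1 / 3)) (i : Fin 6) (v : Plane) :
    ‖(WithLp.toLp 2 ((A α i).mulVec (WithLp.ofLp v)) : Plane)‖ ≤ (1 / 2) * ‖v‖ := by
  obtain ⟨h0, h1⟩ := hα
  have h3 : √3 * √3 = (3 : ℝ) := Real.mul_self_sqrt (by norm_num)
  rw [EuclideanSpace.norm_eq, EuclideanSpace.norm_eq]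
  rw [Real.sqrt_le_left (by positivity), mul_pow, Real.sq_sqrt (by positivity)]
  have hα2 : α ^ 2 ≤ 1 / 4 := by nlinarith
  have hb2 : ((1 - α) / 2) ^ 2 ≤ 1 / 4 := by nlinarith
  set x := v 0 with hx
  set y := v 1 with hy
  have key : ∀ q s : ℝ, 0 ≤ s → q ≤ 1 / 4 → q * s ≤ 1 / 4 * s := fun q s hs hq =>
    mul_le_mul_of_nonneg_right hq hs
  have hs : 0 ≤ x ^ 2 + y ^ 2 := by positivity
  fin_cases i <;>
    simp [A, Matrix.mulVec, dotProduct, Fin.sum_univ_two, ← hx, ← hy, Matrix.one_apply]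
  iterate 3
    · rw [mul_pow, mul_pow, div_pow, sq_abs, sq_abs, sq_abs]
      nlinarith [key _ _ hs hb2]
  · have e : (α / 4 * x + -(α / 4 * √3 * y)) ^ 2 + (-(α / 4 * √3 * x) + α / 4 * 3 * y) ^ 2
        = α ^ 2 * (x ^ 2 + y ^ 2) - α ^ 2 / 4 * (√3 * x + y) ^ 2 := by
      have h4 : √3 ^ 2 = (3 : ℝ) := by rw [sq]; exact h3
      ring_nf
      rw [h4]
      ring
    nlinarith [key _ _ hs hα2, mul_nonneg (sq_nonneg α) (sq_nonneg (√3 * x + y))]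
  · nlinarith [key _ _ hs hα2, mul_nonneg (sq_nonneg α) (sq_nonneg y)]
  · have e : (α / 4 * x + α / 4 * √3 * y) ^ 2 + (α / 4 * √3 * x + α / 4 * 3 * y) ^ 2
        = α ^ 2 * (x ^ 2 + y ^ 2) - α ^ 2 / 4 * (√3 * x - y) ^ 2 := by
      have h4 : √3 ^ 2 = (3 : ℝ) := by rw [sq]; exact h3
      ring_nf
      rw [h4]
      ring
    nlinarith [key _ _ hs hα2, mul_nonneg (sq_nonneg α) (sq_nonneg (√3 * x - y))]

theorem lipschitzWith_G (α : ℝ) (hα : α ∈ Ioo (0 : ℝ) (1 / 3)) (i : Fin 6) :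
    LipschitzWith (1 / 2) (G α i) := by
  refine LipschitzWith.of_dist_le_mul fun x y => ?_
  have h := norm_mulVec_A_le α hα i (x - y)
  have e : G α i x - G α i y
      = WithLp.toLp 2 ((A α i).mulVec (WithLp.ofLp (x - y))) := by
    have : x - y = (x - p i) - (y - p i) := by abel
    rw [this, WithLp.ofLp_sub, Matrix.mulVec_sub, WithLp.toLp_sub]
    simp only [G]
    abel
  rw [dist_eq_norm, dist_eq_norm, e]
  simpa using h

open TopologicalSpace in
/-- The union of the images of a nonempty compact set under the six contractions. -/
def hutchinson (α : ℝ) (hα : α ∈ Ioo (0 : ℝ) (1 / 3)) (C : NonemptyCompacts Plane) :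
    NonemptyCompacts Plane where
  carrier := ⋃ i, G α i '' C
  isCompact' := isCompact_iUnion fun i => C.isCompact.image (lipschitzWith_G α hα i).continuous
  nonempty' := Set.nonempty_iUnion.2 ⟨0, C.nonempty.image _⟩

open TopologicalSpace in
theorem contractingWith_hutchinson (α : ℝ) (hα : α ∈ Ioo (0 : ℝ) (1 / 3)) :
    ContractingWith (1 / 2) (hutchinson α hα) := by
  refine ⟨by rw [← NNReal.coe_lt_coe]; norm_num, fun C D => ?_⟩
  have one : ∀ (C D : NonemptyCompacts Plane) (i : Fin 6), ∀ x ∈ G α i '' (C : Set Plane),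
      Metric.infEDist x (G α i '' (D : Set Plane)) ≤ ((1 / 2 : NNReal) : ENNReal) * edist C D := by
    rintro C D i _ ⟨x, hx, rfl⟩
    obtain ⟨y, hy, hxy⟩ := D.isCompact.exists_infEDist_eq_edist D.nonempty x
    calc Metric.infEDist (G α i x) (G α i '' (D : Set Plane))
        ≤ edist (G α i x) (G α i y) := Metric.infEDist_le_edist_of_mem (mem_image_of_mem _ hy)
      _ ≤ ((1 / 2 : NNReal) : ENNReal) * edist x y := lipschitzWith_G α hα i x y
      _ ≤ ((1 / 2 : NNReal) : ENNReal) * edist C D := by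
          gcongr
          rw [← hxy]
          exact Metric.infEDist_le_hausdorffEDist_of_mem hx
  change Metric.hausdorffEDist (⋃ i, G α i '' (C : Set Plane)) (⋃ i, G α i '' (D : Set Plane)) ≤ _
  refine Metric.hausdorffEDist_iUnion_le.trans (iSup_le fun i => ?_)
  refine Metric.hausdorffEDist_le_of_infEDist (one C D i) ?_
  rw [edist_comm]
  exact one D C i

open TopologicalSpace in
theorem existsUnique_attractor (α : ℝ) (hα : α ∈ Ioo (0 : ℝ) (1 / 3)) :
    ∃! C : NonemptyCompacts Plane, (C : Set Plane) = ⋃ i, G α i '' (C : Set Plane) := by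
  have hne : Nonempty (NonemptyCompacts Plane) := ⟨{0}⟩
  have hc := contractingWith_hutchinson α hα
  refine ⟨ContractingWith.fixedPoint _ hc, ?_, fun D hD => hc.fixedPoint_unique ?_⟩
  · exact (congrArg (fun C : NonemptyCompacts Plane => (C : Set Plane))
      hc.fixedPoint_isFixedPt).symm
  · exact NonemptyCompacts.ext hD.symm

/-- The Hanoi attractor `K_α`: the unique nonempty compact set with `K = ⋃ i, G_{α,i}(K)`. -/
def K (α : ℝ) (hα : α ∈ Ioo (0 : ℝ) (1 / 3)) : Set Plane :=
  (existsUnique_attractor α hα).choose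

theorem K_eq (α : ℝ) (hα : α ∈ Ioo (0 : ℝ) (1 / 3)) : K α hα = ⋃ i, G α i '' K α hα :=
  (existsUnique_attractor α hα).choose_spec.1

/-! ### The approximating sets -/

/-- A symbol of the three-letter alphabet, as one of the six indices. -/
def sym (i : Fin 3) : Fin 6 := Fin.castLE (by norm_num) i

/-- `G_w = G_{w₁} ∘ ⋯ ∘ G_{w_n}` for a word `w` of length `n` over the three-letter alphabet. -/
def wordMap (α : ℝ) : (n : ℕ) → (Fin n → Fin 3) → Plane → Plane
  | 0, _ => id
  | n + 1, w => G α (sym (w 0)) ∘ wordMap α n (Fin.tail w)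

/-- With `{i,j,k}` the three symbols, `e_i` is the open segment joining `G_j(p_k)` and `G_k(p_j)`;
`segA` and `segB` are its endpoints (addition of symbols is modulo three). -/
def segA (α : ℝ) (i : Fin 3) : Plane := G α (sym (i + 1)) (p (sym (i + 2)))

/-- The other endpoint of `e_i`, see `segA`. -/
def segB (α : ℝ) (i : Fin 3) : Plane := G α (sym (i + 2)) (p (sym (i + 1)))

/-- The vertices `W_n`. -/
def W (α : ℝ) (n : ℕ) : Set Plane :=
  ⋃ w : Fin n → Fin 3, wordMap α n w '' {p 0, p 1, p 2}

/-- The union `J_n` of the open segments `G_w(e_i)`, `w` of length `< n`. -/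
def J (α : ℝ) (n : ℕ) : Set Plane :=
  ⋃ m ∈ Finset.range n, ⋃ w : Fin m → Fin 3,
    wordMap α m w '' ⋃ i : Fin 3, openSegment ℝ (segA α i) (segB α i)

def V (α : ℝ) (n : ℕ) : Set Plane := W α n ∪ J α n

/-- `V_* = ⋃ n, V_n`. -/
def VStar (α : ℝ) : Set Plane := ⋃ n, V α n

/-- The affine parametrisation `φ_e` on `[0,1]` of the closure of `e = G_w(e_i)`. -/
def segParam (α : ℝ) (m : ℕ) (w : Fin m → Fin 3) (i : Fin 3) (t : ℝ) : Plane :=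
  AffineMap.lineMap (wordMap α m w (segA α i)) (wordMap α m w (segB α i)) t

/-! ### Energies -/

/-- Membership in `H¹(0,1)` for a function with prescribed values on `[0,1]`: on `[0,1]` it is the
continuous representative of an element of `H¹(0,1)`, i.e. it is absolutely continuous there with
square-integrable derivative. -/
def IsH1 (g : ℝ → ℝ) : Prop :=
  AbsolutelyContinuousOnInterval g 0 1 ∧ MemLp (deriv g) 2 (volume.restrict (Ioo (0 : ℝ) 1))

/-- A function on a subset of the plane, continued by zero. Below only its values at points of the
subset are used. -/
def zeroExt {X : Set Plane} (u : X → ℝ) : Plane → ℝ := Function.extend Subtype.val u 0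

/-- The condition `u|_{V_n} ∈ 𝒟_n`: `u` is `H¹` along each segment of `J_n`, up to the endpoints.
It only involves the values of `u` on `V_n`. (The segments `G_w(e_i)` have pairwise disjoint
closures, so they are the connected components of `J_n`.) -/
def InLevelDomain (α : ℝ) (n : ℕ) (f : Plane → ℝ) : Prop :=
  ∀ m < n, ∀ (w : Fin m → Fin 3) (i : Fin 3), IsH1 (f ∘ segParam α m w i)

/-- The discrete energy `E_n^d`: the sum of `(u(x) - u(y))²` over unordered pairs of
`n`-neighbours, i.e. pairs of distinct vertices of a common triangle `G_w(p₁,p₂,p₃)` with `w` of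
length `n` (these triangles are pairwise disjoint; the pair of vertices is indexed by the
remaining third symbol `i`). -/
def discreteEnergy (α : ℝ) (n : ℕ) (f : Plane → ℝ) : ℝ :=
  ∑ w : Fin n → Fin 3, ∑ i : Fin 3,
    (f (wordMap α n w (p (sym (i + 1)))) - f (wordMap α n w (p (sym (i + 2))))) ^ 2

/-- The continuous energy `∑ ∫₀¹ |(u ∘ φ_e)'|² dt` over the components `e` of
`J_{m+1} ∖ J_m`, i.e. over `e = G_w(e_i)` with `w` of length `m`. -/
def continuousEnergy (α : ℝ) (m : ℕ) (f : Plane → ℝ) : ℝ :=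
  ∑ w : Fin m → Fin 3, ∑ i : Fin 3, ∫ t in (0 : ℝ)..1, (deriv (f ∘ segParam α m w i) t) ^ 2

/-- `d_n = α ((1 - α) / 2) ^ (n - 1)` for `n ≥ 1`, and `d_0 = 0`. -/
def d (α : ℝ) : ℕ → ℝ
  | 0 => 0
  | n + 1 => α * ((1 - α) / 2) ^ n

def rD (α : ℝ) (n : ℕ) : ℝ := 3 / (5 + 3 * d α n)

def rC (α : ℝ) (n : ℕ) : ℝ := 3 * d α n / (5 + 3 * d α n)

/-- `ρ_n^d = ∏_{i=1}^n r_i^d`. -/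
def rhoD (α : ℝ) (n : ℕ) : ℝ := ∏ i ∈ Finset.range n, rD α (i + 1)

/-- `rhoC α m` is `ρ_{m+1}^c = ρ_m^d r_{m+1}^c`. -/
def rhoC (α : ℝ) (m : ℕ) : ℝ := rhoD α m * rC α (m + 1)

/-- The renormalised energy `ℰ_n`. -/
def levelEnergy (α : ℝ) (n : ℕ) (f : Plane → ℝ) : ℝ :=
  (rhoD α n)⁻¹ * discreteEnergy α n f
    + ∑ m ∈ Finset.range n, (rhoC α m)⁻¹ * continuousEnergy α m f

/-! ### The limit form -/

/-- `𝒟_*`: functions on `V_*` in all level domains whose level energies have a finite limit. -/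
def DStar (α : ℝ) : Set (VStar α → ℝ) :=
  {v | (∀ n, InLevelDomain α n (zeroExt v)) ∧
    ∃ L : ℝ, Tendsto (fun n => levelEnergy α n (zeroExt v)) atTop (𝓝 L)}

/-- The extension of a function on `V_*` to `K_α` by limits along `V_*`. -/
def extendToK (α : ℝ) (hα : α ∈ Ioo (0 : ℝ) (1 / 3)) (v : VStar α → ℝ) : K α hα → ℝ :=
  fun x => extendFrom (VStar α) (zeroExt v) x

/-- The domain `ℱ`: elements of `𝒟_*`, viewed as functions on `K_α`. -/
def F (α : ℝ) (hα : α ∈ Ioo (0 : ℝ) (1 / 3)) : Set (K α hα → ℝ) :=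
  extendToK α hα '' DStar α

/-- `ℰ[u] = lim ℰ_n[u|_{V_n}]`. -/
def energy (α : ℝ) (hα : α ∈ Ioo (0 : ℝ) (1 / 3)) (u : K α hα → ℝ) : ℝ :=
  limUnder atTop (fun n => levelEnergy α n (zeroExt u))

/-- The bilinear form `ℰ(u,v)` obtained from `ℰ[u]` by polarization. -/
def form (α : ℝ) (hα : α ∈ Ioo (0 : ℝ) (1 / 3)) (u v : K α hα → ℝ) : ℝ :=
  (1 / 2) * (energy α hα (u + v) - energy α hα u - energy α hα v)

/-- Resistance forms on a set `X`; the values of `E` outside `F × F` are irrelevant. -/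
structure IsResistanceForm {X : Type*} (F : Set (X → ℝ)) (E : (X → ℝ) → (X → ℝ) → ℝ) : Prop where
  const_mem : ∀ c : ℝ, (fun _ => c) ∈ F
  add_mem : ∀ u ∈ F, ∀ v ∈ F, u + v ∈ F
  smul_mem : ∀ c : ℝ, ∀ u ∈ F, c • u ∈ F
  symm : ∀ u ∈ F, ∀ v ∈ F, E u v = E v u
  add_left : ∀ u ∈ F, ∀ v ∈ F, ∀ w ∈ F, E (u + v) w = E u w + E v w
  smul_left : ∀ c : ℝ, ∀ u ∈ F, ∀ v ∈ F, E (c • u) v = c * E u v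
  nonneg : ∀ u ∈ F, 0 ≤ E u u
  eq_zero_iff : ∀ u ∈ F, E u u = 0 ↔ ∃ c : ℝ, u = fun _ => c
  /-- Completeness of `F` modulo constants for the metric `E(u - v, u - v)^{1/2}`. -/
  complete : ∀ s : ℕ → X → ℝ, (∀ n, s n ∈ F) →
    (∀ ε > 0, ∃ N, ∀ m ≥ N, ∀ n ≥ N, E (s m - s n) (s m - s n) < ε) →
    ∃ u ∈ F, Tendsto (fun n => E (s n - u) (s n - u)) atTop (𝓝 0)
  separates : ∀ x y : X, x ≠ y → ∃ u ∈ F, u x ≠ u y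
  /-- The supremum defining the resistance metric is finite. -/
  resistance_finite : ∀ x y : X,
    BddAbove {r : ℝ | ∃ u ∈ F, 0 < E u u ∧ r = |u x - u y| ^ 2 / E u u}
  markov : ∀ u ∈ F, (fun x => min (max 0 (u x)) 1) ∈ F ∧
    E (fun x => min (max 0 (u x)) 1) (fun x => min (max 0 (u x)) 1) ≤ E u u

end Hanoi

end

noncomputable section

namespace Hanoi

/-! ### Functions of class `H¹` on the unit interval -/

/-! The weights are tuned so that one refinement step loses no energy. Inside a triangle, view the
three subtriangles and the three joining segments as a resistor network. With the factors `rD` and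
`rC`, minimising over the new values with the corner values fixed gives back exactly the energy of
the unsubdivided triangle. This is an exact Pythagoras identity, proved inside `triangle_energy_le`.
A segment carrying an `H¹` function costs at least the squared jump between its ends
(`IsH1.sq_sub_le`, Cauchy-Schwarz), so the level energies increase.

An energy bound `E` controls oscillation. Both `rhoD α n` and `rhoC α n` are at most `((4 / 5) ^ n)
^ 2`, hence differences between vertices of a level-`n` cell, and increments along a segment inside
it, are at most `(4 / 5) ^ n * √E`. Summing a geometric series bounds the oscillation of `f` over
all of `V_*` inside the cell (`oscBound_of_mem_VStar`). Cells of one level are disjoint and closed,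
and together with finitely many closed segments they cover `K`; on each segment `f` is continuous.
This yields continuity on `V_*` and limits at every other point of `K`, so `ℱ` is the set of
continuous functions with bounded level energies (`mem_F_iff`).

The resistance form axioms follow. Algebraic identities pass to the limit from the level forms
(`tendsto_form`). The oscillation bound at level 0 gives the kernel and finite resistances. Clamping
does not increase any level energy. Points are separated by Lipschitz functions constant on small
cells, whose energy stops changing after finitely many levels. For completeness, an energy-Cauchy
sequence normalised at `p₁` converges uniformly, and at each fixed level its energies converge to
those of the limit. -/

/-- The Dirichlet form on the unit interval. -/
def dirichlet (f g : ℝ → ℝ) : ℝ := ∫ t in (0 : ℝ)..1, deriv f t * deriv g t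

theorem dirichlet_self (f : ℝ → ℝ) : dirichlet f f = ∫ t in (0 : ℝ)..1, (deriv f t) ^ 2 := by
  simp only [dirichlet, sq]

theorem dirichlet_eq_setIntegral (f g : ℝ → ℝ) :
    dirichlet f g = ∫ t in Ioo (0 : ℝ) 1, deriv f t * deriv g t := by
  rw [dirichlet, intervalIntegral.integral_of_le zero_le_one, integral_Ioc_eq_integral_Ioo]

theorem dirichlet_comm (f g : ℝ → ℝ) : dirichlet f g = dirichlet g f := by
  simp only [dirichlet, mul_comm]

theorem dirichlet_self_nonneg (f : ℝ → ℝ) : 0 ≤ dirichlet f f := by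
  rw [dirichlet_eq_setIntegral]
  exact integral_nonneg fun t => mul_self_nonneg _

theorem deriv_eq_of_eqOn_Icc {f g : ℝ → ℝ} (h : EqOn f g (Icc 0 1)) {t : ℝ}
    (ht : t ∈ Ioo (0 : ℝ) 1) : deriv f t = deriv g t :=
  Filter.EventuallyEq.deriv_eq (h.eventuallyEq_of_mem (Icc_mem_nhds ht.1 ht.2))

theorem dirichlet_congr {f g f' g' : ℝ → ℝ} (h : EqOn f g (Icc 0 1)) (h' : EqOn f' g' (Icc 0 1)) :
    dirichlet f f' = dirichlet g g' := by
  rw [dirichlet_eq_setIntegral, dirichlet_eq_setIntegral]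
  refine setIntegral_congr_fun measurableSet_Ioo fun t ht => ?_
  simp only [deriv_eq_of_eqOn_Icc h ht, deriv_eq_of_eqOn_Icc h' ht]

/-- Absolute continuity sees only values on `[0,1]`, and at interior points so does the derivative.
This makes the choice of extension outside `V_*` immaterial. -/
theorem IsH1.congr {f g : ℝ → ℝ} (hf : IsH1 f) (h : EqOn f g (Icc 0 1)) : IsH1 g := by
  refine ⟨?_, hf.2.ae_eq ?_⟩
  · rw [absolutelyContinuousOnInterval_iff]
    intro ε hε
    obtain ⟨δ, hδ, H⟩ := (absolutelyContinuousOnInterval_iff f 0 1).1 hf.1 ε hε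
    refine ⟨δ, hδ, fun E hE hs => ?_⟩
    have key : ∀ i ∈ Finset.range E.1, dist (g (E.2 i).1) (g (E.2 i).2)
        = dist (f (E.2 i).1) (f (E.2 i).2) := by
      intro i hi
      have := hE.1 i hi
      rw [uIcc_of_le zero_le_one] at this
      rw [h this.1, h this.2]
    rw [Finset.sum_congr rfl key]
    exact H E hE hs
  · exact (ae_restrict_mem measurableSet_Ioo).mono fun t ht => deriv_eq_of_eqOn_Icc h ht

theorem IsH1.ae_differentiableAt {f : ℝ → ℝ} (hf : IsH1 f) :
    ∀ᵐ t ∂volume.restrict (Ioo (0 : ℝ) 1), DifferentiableAt ℝ f t := by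
  rw [ae_restrict_iff' measurableSet_Ioo]
  filter_upwards [hf.1.ae_differentiableAt] with t ht h
  exact ht (by rw [uIcc_of_le zero_le_one]; exact Ioo_subset_Icc_self h)

theorem IsH1.deriv_add_ae {f g : ℝ → ℝ} (hf : IsH1 f) (hg : IsH1 g) :
    deriv (f + g) =ᵐ[volume.restrict (Ioo (0 : ℝ) 1)] deriv f + deriv g := by
  filter_upwards [hf.ae_differentiableAt, hg.ae_differentiableAt] with t h1 h2
  rw [deriv_add h1 h2, Pi.add_apply]

theorem IsH1.add {f g : ℝ → ℝ} (hf : IsH1 f) (hg : IsH1 g) : IsH1 (f + g) :=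
  ⟨hf.1.add hg.1, (hf.2.add hg.2).ae_eq (hf.deriv_add_ae hg).symm⟩

/-- No differentiability is needed: for `c ≠ 0` both functions are differentiable at the same
points, and where they are not both sides are 0; for `c = 0` both sides vanish. -/
theorem deriv_const_smul_fun (c : ℝ) (f : ℝ → ℝ) : deriv (c • f) = c • deriv f := by
  ext t
  rw [deriv_const_smul_field]
  rfl

theorem IsH1.const_smul {f : ℝ → ℝ} (hf : IsH1 f) (c : ℝ) : IsH1 (c • f) := by
  refine ⟨hf.1.const_smul c, ?_⟩
  rw [deriv_const_smul_fun]
  exact hf.2.const_smul c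

theorem IsH1.sub {f g : ℝ → ℝ} (hf : IsH1 f) (hg : IsH1 g) : IsH1 (f - g) := by
  have := hf.add (hg.const_smul (-1))
  rwa [neg_one_smul, ← sub_eq_add_neg] at this

theorem IsH1.integrable_mul {f g : ℝ → ℝ} (hf : IsH1 f) (hg : IsH1 g) :
    Integrable (fun t => deriv f t * deriv g t) (volume.restrict (Ioo (0 : ℝ) 1)) :=
  hf.2.integrable_mul hg.2

theorem dirichlet_add_left {f g h : ℝ → ℝ} (hf : IsH1 f) (hg : IsH1 g) (hh : IsH1 h) :
    dirichlet (f + g) h = dirichlet f h + dirichlet g h := by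
  simp only [dirichlet_eq_setIntegral]
  rw [← integral_add (hf.integrable_mul hh) (hg.integrable_mul hh)]
  refine integral_congr_ae ?_
  filter_upwards [hf.deriv_add_ae hg] with t ht
  rw [ht, Pi.add_apply, add_mul]

theorem dirichlet_smul_left (c : ℝ) (f h : ℝ → ℝ) :
    dirichlet (c • f) h = c * dirichlet f h := by
  simp only [dirichlet_eq_setIntegral, deriv_const_smul_fun, Pi.smul_apply, smul_eq_mul, mul_assoc,
    integral_const_mul]

theorem IsH1.continuousOn {f : ℝ → ℝ} (hf : IsH1 f) : ContinuousOn f (Icc 0 1) := by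
  have := hf.1.continuousOn
  rwa [uIcc_of_le zero_le_one] at this

/-- The Cauchy-Schwarz inequality on a set of measure at most one. -/
theorem sq_setIntegral_le {h : ℝ → ℝ} (hh : MemLp h 2 (volume.restrict (Ioo (0 : ℝ) 1)))
    {s : Set ℝ} (hs : s ⊆ Ioo 0 1) :
    (∫ t in s, h t) ^ 2 ≤ ∫ t in Ioo (0 : ℝ) 1, h t ^ 2 := by
  have hμs : volume s ≤ 1 := (measure_mono hs).trans (by simp)
  have hfin : IsFiniteMeasure (volume.restrict s) :=
    ⟨by rw [Measure.restrict_apply_univ]; exact hμs.trans_lt ENNReal.one_lt_top⟩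
  have hmem : MemLp h 2 (volume.restrict s) := hh.mono_measure (Measure.restrict_mono hs le_rfl)
  have hint : Integrable h (volume.restrict s) := hmem.integrable (by norm_num)
  have hsq : Integrable (fun t => h t ^ 2) (volume.restrict s) := hmem.integrable_sq
  have hle : ∫ t in s, h t ^ 2 ≤ ∫ t in Ioo (0 : ℝ) 1, h t ^ 2 :=
    setIntegral_mono_set hh.integrable_sq (Eventually.of_forall fun t => sq_nonneg _)
      (LE.le.eventuallyLE hs)
  refine le_trans ?_ hle
  -- Expanding `0 ≤ ∫ (h - I)²` over `s` gives `∫ h² ≥ (2 - |s|) I²`, which is at least `I²` because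
  -- `|s| ≤ 1`.
  set I := ∫ t in s, h t with hI
  have h1 : 0 ≤ ∫ t in s, (h t - I) ^ 2 := integral_nonneg fun t => sq_nonneg _
  have h2 : ∫ t in s, (h t - I) ^ 2 = (∫ t in s, h t ^ 2) - 2 * I * I + volume.real s * I ^ 2 := by
    have e : (fun t => (h t - I) ^ 2) = fun t => (h t ^ 2 - (2 * I) * h t) + I ^ 2 := by
      ext t; ring
    have e1 : ∫ t in s, (h t ^ 2 - (2 * I) * h t) + I ^ 2
        = (∫ t in s, h t ^ 2 - (2 * I) * h t) + ∫ t in s, I ^ 2 :=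
      integral_add (hsq.sub (hint.const_mul _)) (integrable_const _)
    have e2 : ∫ t in s, h t ^ 2 - (2 * I) * h t = (∫ t in s, h t ^ 2) - ∫ t in s, (2 * I) * h t :=
      integral_sub hsq (hint.const_mul _)
    rw [e, e1, e2, integral_const_mul, integral_const]
    simp [hI]
  have h3 : volume.real s ≤ 1 := ENNReal.toReal_mono ENNReal.one_ne_top hμs
  nlinarith [sq_nonneg I]

theorem IsH1.sq_sub_le {f : ℝ → ℝ} (hf : IsH1 f) {a b : ℝ} (ha : a ∈ Icc (0 : ℝ) 1)
    (hb : b ∈ Icc (0 : ℝ) 1) : (f b - f a) ^ 2 ≤ dirichlet f f := by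
  wlog hab : a ≤ b generalizing a b
  · rw [← neg_sq, neg_sub]
    exact this hb ha (le_of_not_ge hab)
  have hac : AbsolutelyContinuousOnInterval f a b := hf.1.mono (by
    rw [uIcc_of_le zero_le_one, uIcc_of_le hab]
    exact Icc_subset_Icc ha.1 hb.2)
  rw [← hac.integral_deriv_eq_sub, intervalIntegral.integral_of_le hab,
    integral_Ioc_eq_integral_Ioo, dirichlet_eq_setIntegral]
  simp only [← sq]
  exact sq_setIntegral_le hf.2 (Ioo_subset_Ioo ha.1 hb.2)

theorem isH1_of_lipschitzWith {f : ℝ → ℝ} {C : NNReal} (hf : LipschitzWith C f) : IsH1 f := by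
  refine ⟨(hf.lipschitzOnWith (s := uIcc 0 1)).absolutelyContinuousOnInterval, ?_⟩
  exact MemLp.of_bound (measurable_deriv f).aestronglyMeasurable C
    (Eventually.of_forall fun t => norm_deriv_le_of_lipschitz hf)

/-- The difference quotients of `φ ∘ f` are dominated by those of `f`. Where `φ ∘ f` has no
derivative, `deriv` is 0. -/
theorem abs_deriv_comp_le {f φ : ℝ → ℝ} (hφ : LipschitzWith 1 φ) {t : ℝ}
    (hf : DifferentiableAt ℝ f t) : |deriv (φ ∘ f) t| ≤ |deriv f t| := by
  by_cases hd : DifferentiableAt ℝ (φ ∘ f) t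
  · have h1 := (hasDerivAt_iff_tendsto_slope.1 hd.hasDerivAt).abs
    have h2 := (hasDerivAt_iff_tendsto_slope.1 hf.hasDerivAt).abs
    refine le_of_tendsto_of_tendsto' h1 h2 fun x => ?_
    rw [slope_def_field, slope_def_field, abs_div, abs_div]
    have := hφ.dist_le_mul (f x) (f t)
    rw [Real.dist_eq, Real.dist_eq, NNReal.coe_one, one_mul] at this
    exact div_le_div_of_nonneg_right this (abs_nonneg _)
  · rw [deriv_zero_of_not_differentiableAt hd, abs_zero]
    exact abs_nonneg _

theorem IsH1.comp_left {f φ : ℝ → ℝ} (hf : IsH1 f) (hφ : LipschitzWith 1 φ) : IsH1 (φ ∘ f) := by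
  refine ⟨?_, hf.2.of_le (measurable_deriv _).aestronglyMeasurable ?_⟩
  -- Absolute continuity is by definition the convergence to 0 of the sums of increments over small
  -- families of disjoint intervals, so it can be squeezed.
  · refine squeeze_zero (fun E => Finset.sum_nonneg fun _ _ => dist_nonneg) (fun E => ?_) hf.1
    refine Finset.sum_le_sum fun i _ => ?_
    simpa using hφ.dist_le_mul (f (E.2 i).1) (f (E.2 i).2)
  · exact hf.ae_differentiableAt.mono fun t ht => abs_deriv_comp_le hφ ht

theorem dirichlet_comp_left_le {f φ : ℝ → ℝ} (hf : IsH1 f) (hφ : LipschitzWith 1 φ) :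
    dirichlet (φ ∘ f) (φ ∘ f) ≤ dirichlet f f := by
  rw [dirichlet_eq_setIntegral, dirichlet_eq_setIntegral]
  refine integral_mono_ae ((hf.comp_left hφ).integrable_mul (hf.comp_left hφ))
    (hf.integrable_mul hf) ?_
  exact hf.ae_differentiableAt.mono fun t ht => abs_le_iff_mul_self_le.1 (abs_deriv_comp_le hφ ht)

theorem norm_sq_eq_integral_sq (u : Lp ℝ 2 (volume.restrict (Ioo (0 : ℝ) 1))) :
    ‖u‖ ^ 2 = ∫ t in Ioo (0 : ℝ) 1, u t ^ 2 := by
  rw [← real_inner_self_eq_norm_sq, L2.inner_def]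
  simp [sq]

/-- If the derivatives are Cauchy in `L²` and the increments converge pointwise, then the limit is
in `H¹`, and convergence holds in the Dirichlet seminorm. -/
theorem isH1_of_tendsto {g : ℕ → ℝ → ℝ} {f : ℝ → ℝ} (hg : ∀ n, IsH1 (g n))
    (hc : ∀ ε > 0, ∃ N, ∀ m ≥ N, ∀ n ≥ N, dirichlet (g m - g n) (g m - g n) < ε)
    (hf : ∀ t ∈ Icc (0 : ℝ) 1, Tendsto (fun n => g n t - g n 0) atTop (𝓝 (f t - f 0))) :
    IsH1 f ∧ Tendsto (fun n => dirichlet (g n - f) (g n - f)) atTop (𝓝 0) := by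
  set μ := volume.restrict (Ioo (0 : ℝ) 1) with hμ
  have hsub : ∀ {p q : ℝ → ℝ}, IsH1 p → IsH1 q → deriv (p - q) =ᵐ[μ] deriv p - deriv q := by
    intro p q hp hq
    filter_upwards [hp.ae_differentiableAt, hq.ae_differentiableAt] with t h1 h2
    rw [deriv_sub h1 h2, Pi.sub_apply]
  let u : ℕ → Lp ℝ 2 μ := fun n => (hg n).2.toLp
  have hu : CauchySeq u := by
    rw [Metric.cauchySeq_iff]
    intro ε hε
    obtain ⟨N, hN⟩ := hc (ε ^ 2) (by positivity)
    refine ⟨N, fun m hm n hn => lt_of_pow_lt_pow_left₀ 2 hε.le ?_⟩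
    rw [dist_eq_norm, norm_sq_eq_integral_sq]
    refine lt_of_eq_of_lt ?_ (hN m hm n hn)
    rw [dirichlet_eq_setIntegral]
    refine integral_congr_ae ?_
    filter_upwards [Lp.coeFn_sub (u m) (u n), (hg m).2.coeFn_toLp, (hg n).2.coeFn_toLp,
      hsub (hg m) (hg n)] with t h1 h2 h3 h4
    rw [h1, h4, Pi.sub_apply, Pi.sub_apply, h2, h3, sq]
  obtain ⟨h, hh⟩ := cauchySeq_tendsto_of_complete hu
  have hmem : MemLp h 2 μ := Lp.memLp h
  have hfin : IsFiniteMeasure μ := ⟨by simp [hμ]⟩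
  have hint : IntegrableOn h (Ioo (0 : ℝ) 1) := hmem.integrable (by norm_num)
  have hii : IntervalIntegrable h volume 0 1 := by
    rw [intervalIntegrable_iff_integrableOn_Ioo_of_le zero_le_one]
    exact hint
  have hnorm : ∀ n, ∫ t in Ioo (0 : ℝ) 1, (deriv (g n) t - h t) ^ 2 = ‖u n - h‖ ^ 2 := by
    intro n
    rw [norm_sq_eq_integral_sq]
    refine integral_congr_ae ?_
    filter_upwards [Lp.coeFn_sub (u n) h, (hg n).2.coeFn_toLp] with t h1 h2
    rw [h1, Pi.sub_apply, h2]
  have hnorm0 : Tendsto (fun n => ‖u n - h‖ ^ 2) atTop (𝓝 0) := by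
    simpa using (tendsto_iff_norm_sub_tendsto_zero.1 hh).pow 2
  -- The primitive of the `L²` limit `h` of the derivatives is the candidate for `f - f 0`.
  let P : ℝ → ℝ := fun t => ∫ s in (0 : ℝ)..t, h s
  have hP : ∀ᵐ t ∂μ, HasDerivAt P (h t) t := by
    refine (ae_restrict_iff' measurableSet_Ioo).2 ?_
    filter_upwards [hii.ae_hasDerivAt_integral] with t ht hmt
    exact ht (by rw [uIcc_of_le zero_le_one]; exact Ioo_subset_Icc_self hmt) 0 (by simp)
  have hPd : deriv P =ᵐ[μ] h := hP.mono fun t ht => ht.deriv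
  have hPf : ∀ t ∈ Icc (0 : ℝ) 1, f t - f 0 = P t := by
    intro t ht
    -- The increments `g n t - g n 0` tend to `f t - f 0` by hypothesis, and to `P t` because they
    -- are integrals of derivatives converging in `L²`.
    refine tendsto_nhds_unique (hf t ht) ?_
    rw [tendsto_iff_norm_sub_tendsto_zero]
    have hle : ∀ n, ‖g n t - g n 0 - P t‖ ≤ ‖u n - h‖ := by
      intro n
      have hac : AbsolutelyContinuousOnInterval (g n) 0 t := (hg n).1.mono (by
        rw [uIcc_of_le zero_le_one, uIcc_of_le ht.1]
        exact Icc_subset_Icc le_rfl ht.2)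
      have hi2 : IntervalIntegrable h volume 0 t := hii.mono_set (by
        rw [uIcc_of_le zero_le_one, uIcc_of_le ht.1]
        exact Icc_subset_Icc le_rfl ht.2)
      rw [← hac.integral_deriv_eq_sub,
        ← intervalIntegral.integral_sub hac.intervalIntegrable_deriv hi2,
        intervalIntegral.integral_of_le ht.1, integral_Ioc_eq_integral_Ioo]
      refine abs_le_of_sq_le_sq ?_ (norm_nonneg _)
      rw [← hnorm]
      exact sq_setIntegral_le ((hg n).2.sub hmem) (Ioo_subset_Ioo le_rfl ht.2)
    exact squeeze_zero (fun n => norm_nonneg _) hle (tendsto_iff_norm_sub_tendsto_zero.1 hh)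
  have hPH : IsH1 P := ⟨hii.absolutelyContinuousOnInterval_intervalIntegral (by simp),
    hmem.ae_eq hPd.symm⟩
  have hfH : IsH1 f := by
    refine (hPH.add (isH1_of_lipschitzWith (LipschitzWith.const (f 0)))).congr fun t ht => ?_
    simp only [Pi.add_apply, ← hPf t ht, sub_add_cancel]
  refine ⟨hfH, ?_⟩
  refine hnorm0.congr fun n => ?_
  rw [← hnorm, dirichlet_eq_setIntegral]
  have hfd : deriv f =ᵐ[μ] h := by
    filter_upwards [hPd, ae_restrict_mem measurableSet_Ioo] with t h1 h2
    rw [← h1, ← deriv_add_const (f := P) (f 0)]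
    exact deriv_eq_of_eqOn_Icc (fun s hs => by rw [← hPf s hs, sub_add_cancel]) h2
  refine integral_congr_ae ?_
  filter_upwards [hsub (hg n) hfH, hfd] with t h1 h2
  rw [h1, Pi.sub_apply, h2, sq]

/-! ### Geometry of the attractor -/

/-- The index of the degenerate contraction onto the closure of `e_i`. -/
def mid (i : Fin 3) : Fin 6 := Fin.natAdd 3 i

theorem eq_sym_or_eq_mid : ∀ k : Fin 6, (∃ i, k = sym i) ∨ ∃ i, k = mid i := by decide

/-- Barycentric coordinates with respect to the vertices of the triangle. -/
def bary : Fin 3 → Plane → ℝ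
  | 0 => fun x => 1 - x 0 - √3 / 3 * x 1
  | 1 => fun x => 2 * (√3 / 3) * x 1
  | 2 => fun x => x 0 - √3 / 3 * x 1

theorem sqrt_three_mul_self : √3 * √3 = (3 : ℝ) := Real.mul_self_sqrt (by norm_num)

theorem bary_add_add (i : Fin 3) (x : Plane) :
    bary i x + bary (i + 1) x + bary (i + 2) x = 1 := by
  fin_cases i <;> simp [bary] <;> ring

theorem bary_vertex (i j : Fin 3) : bary i (p (sym j)) = if i = j then 1 else 0 := by
  have h := sqrt_three_mul_self
  fin_cases i <;> fin_cases j <;> simp [bary, p, sym] <;> nlinarith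

/-- Lets equalities of points be checked on barycentric coordinates, in which the contractions are
free of `√3`. -/
theorem bary_ext {x y : Plane} (h : ∀ i, bary i x = bary i y) : x = y := by
  have h1 := h 1
  have h2 := h 2
  simp only [bary] at h1 h2
  have h3 : (0 : ℝ) < √3 := by positivity
  have e1 : x 1 = y 1 := by
    have : 2 * (√3 / 3) ≠ 0 := by positivity
    exact mul_left_cancel₀ this h1
  ext j
  fin_cases j
  · simpa [e1] using h2
  · exact e1

theorem bary_lineMap (i : Fin 3) (x y : Plane) (t : ℝ) :
    bary i (AffineMap.lineMap x y t) = (1 - t) * bary i x + t * bary i y := by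
  fin_cases i <;> simp [bary, AffineMap.lineMap_apply] <;> ring

theorem continuous_bary (i : Fin 3) : Continuous (bary i) := by
  fin_cases i <;> simp only [bary] <;> fun_prop

theorem G_sym (α : ℝ) (i : Fin 3) (x : Plane) :
    G α (sym i) x = ((1 - α) / 2) • (x - p (sym i)) + p (sym i) := by
  have : A α (sym i) = ((1 - α) / 2) • (1 : Matrix (Fin 2) (Fin 2) ℝ) := by
    fin_cases i <;> rfl
  rw [G, this, Matrix.smul_mulVec, Matrix.one_mulVec]
  rfl

theorem G_sym_vertex (α : ℝ) (i : Fin 3) : G α (sym i) (p (sym i)) = p (sym i) := by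
  simp [G_sym]

theorem bary_G_sym (α : ℝ) (i j : Fin 3) (x : Plane) :
    bary i (G α (sym j) x)
      = (1 - α) / 2 * bary i x + (1 + α) / 2 * (if i = j then 1 else 0) := by
  rw [← bary_vertex, G_sym]
  fin_cases i <;> simp [bary] <;> ring

theorem G_sym_lineMap (α : ℝ) (i : Fin 3) (x y : Plane) (t : ℝ) :
    G α (sym i) (AffineMap.lineMap x y t)
      = AffineMap.lineMap (G α (sym i) x) (G α (sym i) y) t := by
  refine bary_ext fun j => ?_
  simp only [bary_G_sym, bary_lineMap]
  ring

theorem dist_G_sym (α : ℝ) (hα : α ∈ Ioo (0 : ℝ) (1 / 3)) (i : Fin 3) (x y : Plane) :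
    dist (G α (sym i) x) (G α (sym i) y) = (1 - α) / 2 * dist x y := by
  have h : 0 ≤ (1 - α) / 2 := by linarith [hα.2]
  rw [G_sym, G_sym, dist_add_right, dist_smul₀, dist_sub_right, Real.norm_of_nonneg h]

/-- The parametrisation of the closure of `e_i`. -/
def seg (α : ℝ) (i : Fin 3) (t : ℝ) : Plane := AffineMap.lineMap (segA α i) (segB α i) t

/-- The map first projects orthogonally onto the side opposite to vertex `i`. That vertex goes to
the midpoint of the side, hence the weight `1 / 2` on `bary i x`. -/
theorem G_mid (α : ℝ) (i : Fin 3) (x : Plane) :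
    G α (mid i) x = seg α i (bary (i + 2) x + bary i x / 2) := by
  have h := sqrt_three_mul_self
  have h' : √3 ^ 2 = (3 : ℝ) := by rw [sq, h]
  rw [seg, AffineMap.lineMap_apply, segA, segB]
  fin_cases i
  all_goals
    ext j
    fin_cases j
  all_goals
    simp [G, A, mid, sym, p, bary, Matrix.vecHead, Matrix.vecTail]
    try ring_nf
    try simp only [h']
    try ring_nf

theorem bary_seg (α : ℝ) (i j : Fin 3) (t : ℝ) :
    bary j (seg α i t) = (if j = i + 1 then (1 + α) / 2 - α * t else 0)
      + (if j = i + 2 then (1 - α) / 2 + α * t else 0) := by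
  rw [seg, bary_lineMap, segA, segB, bary_G_sym, bary_G_sym, bary_vertex, bary_vertex]
  fin_cases i <;> fin_cases j <;> simp <;> ring

/-! ### Words -/

variable {α : ℝ}

theorem wordMap_cons (α : ℝ) (n : ℕ) (i : Fin 3) (w : Fin n → Fin 3) :
    wordMap α (n + 1) (Fin.cons i w) = G α (sym i) ∘ wordMap α n w := by
  simp [wordMap]

/-- `wordMap` peels off the outermost letter, whereas subdividing a cell appends an innermost one.
-/
theorem wordMap_snoc (α : ℝ) : ∀ (n : ℕ) (w : Fin n → Fin 3) (i : Fin 3),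
    wordMap α (n + 1) (Fin.snoc w i : Fin (n + 1) → Fin 3) = wordMap α n w ∘ G α (sym i) := by
  intro n
  induction n with
  | zero =>
    intro w i
    simp [wordMap, Fin.snoc]
  | succ n ih =>
    intro w i
    rw [← Fin.cons_self_tail w, ← Fin.cons_snoc_eq_snoc_cons, wordMap_cons, ih, wordMap_cons]
    rfl

theorem wordMap_lineMap (α : ℝ) : ∀ (n : ℕ) (w : Fin n → Fin 3) (x y : Plane) (t : ℝ),
    wordMap α n w (AffineMap.lineMap x y t)
      = AffineMap.lineMap (wordMap α n w x) (wordMap α n w y) t := by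
  intro n
  induction n with
  | zero => intro w x y t; rfl
  | succ n ih =>
    intro w x y t
    simp only [wordMap, Function.comp_apply, ih, G_sym_lineMap]

theorem segParam_eq (α : ℝ) (n : ℕ) (w : Fin n → Fin 3) (i : Fin 3) (t : ℝ) :
    segParam α n w i t = wordMap α n w (seg α i t) := by
  rw [segParam, seg, wordMap_lineMap]

theorem dist_wordMap (hα : α ∈ Ioo (0 : ℝ) (1 / 3)) : ∀ (n : ℕ) (w : Fin n → Fin 3) (x y : Plane),
    dist (wordMap α n w x) (wordMap α n w y) = ((1 - α) / 2) ^ n * dist x y := by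
  intro n
  induction n with
  | zero => intro w x y; simp [wordMap]
  | succ n ih =>
    intro w x y
    simp only [wordMap, Function.comp_apply, dist_G_sym α hα, ih]
    ring

theorem G_sym_injective (hα : α ∈ Ioo (0 : ℝ) (1 / 3)) (i : Fin 3) :
    Function.Injective (G α (sym i)) := by
  intro x y h
  rw [← dist_eq_zero, dist_G_sym α hα] at h
  have : (1 - α) / 2 ≠ 0 := by linarith [hα.2]
  simpa [this] using h

/-! ### The triangle and its cells -/

/-- The closed triangle with vertices `p₁, p₂, p₃`. -/
def tri : Set Plane := {x | ∀ i, 0 ≤ bary i x}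

theorem isClosed_tri : IsClosed tri := by
  simp only [tri, ofPred_forall]
  exact isClosed_iInter fun i => isClosed_le continuous_const (continuous_bary i)

theorem vertex_mem_tri (j : Fin 3) : p (sym j) ∈ tri := by
  intro i
  rw [bary_vertex]
  split_ifs <;> norm_num

theorem norm_le_of_mem_tri {x : Plane} (hx : x ∈ tri) : ‖x‖ ≤ 2 := by
  have h0 := hx 0
  have h1 := hx 1
  have h2 := hx 2
  simp only [bary] at h0 h1 h2
  have h3 := sqrt_three_mul_self
  have hs : (0 : ℝ) < √3 := by positivity
  have hy : 0 ≤ √3 / 3 * x 1 := by linarith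
  rw [EuclideanSpace.norm_eq, Real.sqrt_le_left (by norm_num), Fin.sum_univ_two, Real.norm_eq_abs,
    Real.norm_eq_abs, sq_abs, sq_abs]
  have hx0 : 0 ≤ x 0 := by linarith
  have hx1 : x 0 ≤ 1 := by linarith
  have e : x 1 ^ 2 = 3 * (√3 / 3 * x 1) ^ 2 := by
    have : (√3 / 3 * x 1) ^ 2 = (√3 * √3) / 9 * x 1 ^ 2 := by ring
    rw [this, h3]
    ring
  nlinarith

theorem dist_le_of_mem_tri {x y : Plane} (hx : x ∈ tri) (hy : y ∈ tri) : dist x y ≤ 4 := by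
  linarith [dist_le_norm_add_norm x y, norm_le_of_mem_tri hx, norm_le_of_mem_tri hy]

theorem isCompact_tri : IsCompact tri :=
  Metric.isCompact_of_isClosed_isBounded isClosed_tri
    (isBounded_iff_forall_norm_le.2 ⟨2, fun _ => norm_le_of_mem_tri⟩)

theorem G_sym_mem_tri (hα : α ∈ Ioo (0 : ℝ) (1 / 3)) (i : Fin 3) {x : Plane} (hx : x ∈ tri) :
    G α (sym i) x ∈ tri := by
  intro j
  rw [bary_G_sym]
  have h1 : 0 ≤ (1 - α) / 2 := by linarith [hα.2]
  have h2 : 0 ≤ (1 + α) / 2 := by linarith [hα.1]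
  have := hx j
  split_ifs <;> positivity

theorem seg_mem_tri (hα : α ∈ Ioo (0 : ℝ) (1 / 3)) (i : Fin 3) {t : ℝ} (ht : t ∈ Icc (0 : ℝ) 1) :
    seg α i t ∈ tri := by
  intro j
  rw [bary_seg]
  have h1 : 0 ≤ (1 + α) / 2 - α * t := by nlinarith [hα.1, hα.2, ht.2]
  have h2 : 0 ≤ (1 - α) / 2 + α * t := by nlinarith [hα.1, hα.2, ht.1]
  split_ifs <;> linarith

theorem param_mem_Icc (i : Fin 3) {x : Plane} (hx : x ∈ tri) :
    bary (i + 2) x + bary i x / 2 ∈ Icc (0 : ℝ) 1 := by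
  have := bary_add_add i x
  have h0 := hx i
  have h1 := hx (i + 1)
  have h2 := hx (i + 2)
  constructor <;> linarith

theorem G_mem_tri (hα : α ∈ Ioo (0 : ℝ) (1 / 3)) (k : Fin 6) {x : Plane} (hx : x ∈ tri) :
    G α k x ∈ tri := by
  rcases eq_sym_or_eq_mid k with ⟨i, rfl⟩ | ⟨i, rfl⟩
  · exact G_sym_mem_tri hα i hx
  · rw [G_mid]
    exact seg_mem_tri hα i (param_mem_Icc i hx)

theorem wordMap_mem_tri (hα : α ∈ Ioo (0 : ℝ) (1 / 3)) : ∀ (n : ℕ) (w : Fin n → Fin 3) {x : Plane},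
    x ∈ tri → wordMap α n w x ∈ tri := by
  intro n
  induction n with
  | zero => intro w x hx; exact hx
  | succ n ih => intro w x hx; exact G_sym_mem_tri hα _ (ih _ hx)

/-- Coordinate `i` is at least `(1 + α) / 2` on the image under `G_i` and at most `(1 - α) / 2` on
the images under the other two corner maps. -/
theorem eq_of_G_sym_eq (hα : α ∈ Ioo (0 : ℝ) (1 / 3)) {i j : Fin 3} {x y : Plane} (hx : x ∈ tri)
    (hy : y ∈ tri) (h : G α (sym i) x = G α (sym j) y) : i = j ∧ x = y := by
  have hij : i = j := by
    by_contra hne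
    have e1 := bary_G_sym α i i x
    have e2 := bary_G_sym α i j y
    rw [h] at e1
    rw [if_pos rfl] at e1
    rw [if_neg hne] at e2
    have := hx i
    have h1 := hy (i + 1)
    have h2 := hy (i + 2)
    have h3 := bary_add_add i y
    nlinarith [hα.1, hα.2]
  subst hij
  exact ⟨rfl, G_sym_injective hα i h⟩

/-- Distinct cells of the same level are disjoint. -/
theorem eq_of_wordMap_eq (hα : α ∈ Ioo (0 : ℝ) (1 / 3)) : ∀ (n : ℕ) (w w' : Fin n → Fin 3)
    {x y : Plane}, x ∈ tri → y ∈ tri → wordMap α n w x = wordMap α n w' y → w = w' := by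
  intro n
  induction n with
  | zero => intro w w' x y _ _ _; exact Subsingleton.elim _ _
  | succ n ih =>
    intro w w' x y hx hy h
    obtain ⟨h1, h2⟩ := eq_of_G_sym_eq hα (wordMap_mem_tri hα n _ hx) (wordMap_mem_tri hα n _ hy) h
    rw [← Fin.cons_self_tail w, ← Fin.cons_self_tail w', h1, ih _ _ hx hy h2]

/-! ### Density of `V_*` in `K` -/

/-- Each point of `C` is the image of a point of `C`, and each map at least halves the distance to
the invariant set `D`; iterating, that distance is 0. With `D = K` this shows that a bounded set
covered by its images lies in `K`; with `C = K`, that `K` lies in the closure of any nonempty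
invariant set. -/
theorem subset_closure_of_G (hα : α ∈ Ioo (0 : ℝ) (1 / 3)) {C D : Set Plane}
    (hC : Bornology.IsBounded C) (hCG : C ⊆ ⋃ i, G α i '' C) (hD : D.Nonempty)
    (hDG : ∀ i, ∀ x ∈ D, G α i x ∈ D) : C ⊆ closure D := by
  obtain ⟨z, hz⟩ := hD
  obtain ⟨R, hR⟩ := hC.subset_closedBall z
  have key : ∀ n : ℕ, ∀ x ∈ C, Metric.infDist x D ≤ R * (1 / 2) ^ n := by
    intro n
    induction n with
    | zero =>
      intro x hx
      simpa using (Metric.infDist_le_dist_of_mem hz).trans (hR hx)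
    | succ n ih =>
      intro x hx
      obtain ⟨i, y, hy, rfl⟩ := mem_iUnion.1 (hCG hx)
      have h1 : 2 * Metric.infDist (G α i y) D ≤ Metric.infDist y D := by
        rw [Metric.le_infDist ⟨z, hz⟩]
        intro v hv
        have := (lipschitzWith_G α hα i).dist_le_mul y v
        have h2 : Metric.infDist (G α i y) D ≤ dist (G α i y) (G α i v) :=
          Metric.infDist_le_dist_of_mem (hDG i v hv)
        push_cast at this
        linarith
      have := ih y hy
      rw [pow_succ]
      linarith
  intro x hx
  rw [Metric.mem_closure_iff_infDist_zero ⟨z, hz⟩]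
  refine le_antisymm ?_ Metric.infDist_nonneg
  have ht : Tendsto (fun n : ℕ => R * (1 / 2 : ℝ) ^ n) atTop (𝓝 (R * 0)) :=
    (tendsto_pow_atTop_nhds_zero_of_lt_one (by norm_num) (by norm_num)).const_mul R
  rw [mul_zero] at ht
  exact ge_of_tendsto' ht fun n => key n x hx

theorem isCompact_K (hα : α ∈ Ioo (0 : ℝ) (1 / 3)) : IsCompact (K α hα) :=
  (existsUnique_attractor α hα).choose.isCompact

theorem nonempty_K (hα : α ∈ Ioo (0 : ℝ) (1 / 3)) : (K α hα).Nonempty :=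
  (existsUnique_attractor α hα).choose.nonempty

theorem G_mem_K (hα : α ∈ Ioo (0 : ℝ) (1 / 3)) (i : Fin 6) {x : Plane} (hx : x ∈ K α hα) :
    G α i x ∈ K α hα := by
  rw [K_eq]
  exact mem_iUnion.2 ⟨i, x, hx, rfl⟩

theorem subset_K_of_G (hα : α ∈ Ioo (0 : ℝ) (1 / 3)) {C : Set Plane}
    (hC : Bornology.IsBounded C) (hCG : C ⊆ ⋃ i, G α i '' C) : C ⊆ K α hα := by
  have := subset_closure_of_G hα hC hCG (nonempty_K hα) fun i x hx => G_mem_K hα i hx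
  rwa [(isCompact_K hα).isClosed.closure_eq] at this

theorem K_subset_closure_of_G (hα : α ∈ Ioo (0 : ℝ) (1 / 3)) {D : Set Plane} (hD : D.Nonempty)
    (hDG : ∀ i, ∀ x ∈ D, G α i x ∈ D) : K α hα ⊆ closure D :=
  subset_closure_of_G hα (isCompact_K hα).isBounded (K_eq α hα).le hD hDG

theorem K_subset_tri (hα : α ∈ Ioo (0 : ℝ) (1 / 3)) : K α hα ⊆ tri := by
  have := K_subset_closure_of_G hα ⟨_, vertex_mem_tri 0⟩ fun i x hx => G_mem_tri hα i hx
  rwa [isClosed_tri.closure_eq] at this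

theorem vertex_mem_K (hα : α ∈ Ioo (0 : ℝ) (1 / 3)) (i : Fin 3) : p (sym i) ∈ K α hα := by
  refine subset_K_of_G hα (C := {p (sym i)}) Bornology.isBounded_singleton ?_ rfl
  rintro _ rfl
  exact mem_iUnion.2 ⟨sym i, _, rfl, G_sym_vertex α i⟩

/-- The parametrisation of a side of the triangle. -/
def side (i : Fin 3) (t : ℝ) : Plane :=
  AffineMap.lineMap (p (sym (i + 1))) (p (sym (i + 2))) t

theorem bary_side (i j : Fin 3) (t : ℝ) :
    bary j (side i t) = (if j = i + 1 then 1 - t else 0) + (if j = i + 2 then t else 0) := by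
  rw [side, bary_lineMap, bary_vertex, bary_vertex]
  fin_cases i <;> fin_cases j <;> simp

theorem G_mid_side (α : ℝ) (i : Fin 3) (t : ℝ) : G α (mid i) (side i t) = seg α i t := by
  rw [G_mid, bary_side, bary_side]
  congr 1
  fin_cases i <;> simp

/-- A side is the union of three images of itself, meeting at the parameters `(1 - α) / 2` and `(1 +
α) / 2`: two under the corner maps at its ends, the middle one under the degenerate map of that
side. Hence it lies in `K`, and so do all joining segments. -/
theorem side_mem_K (hα : α ∈ Ioo (0 : ℝ) (1 / 3)) (i : Fin 3) {t : ℝ} (ht : t ∈ Icc (0 : ℝ) 1) :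
    side i t ∈ K α hα := by
  have hbd : Bornology.IsBounded (side i '' Icc 0 1) := by
    have : Continuous (side i) := AffineMap.lineMap_continuous
    exact (isCompact_Icc.image this).isBounded
  refine subset_K_of_G hα hbd ?_ ⟨t, ht, rfl⟩
  rintro _ ⟨t, ht, rfl⟩
  have hs : 0 < (1 - α) / 2 := by linarith [hα.2]
  have hs' : (1 - α) ≠ 0 := by linarith [hα.2]
  have h0 := hα.1
  rcases le_total t ((1 - α) / 2) with h | h
  · refine mem_iUnion.2 ⟨sym (i + 1), side i (t / ((1 - α) / 2)),
      ⟨_, ⟨div_nonneg ht.1 hs.le, (div_le_one hs).2 h⟩, rfl⟩, ?_⟩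
    refine bary_ext fun j => ?_
    rw [bary_G_sym, bary_side, bary_side]
    fin_cases i <;> fin_cases j <;> simp <;> field_simp <;> ring
  rcases le_total t ((1 + α) / 2) with h' | h'
  · refine mem_iUnion.2 ⟨mid i, side i ((t - (1 - α) / 2) / α),
      ⟨_, ⟨div_nonneg (by linarith) h0.le, (div_le_one h0).2 (by linarith)⟩, rfl⟩, ?_⟩
    rw [G_mid_side]
    refine bary_ext fun j => ?_
    rw [bary_seg, bary_side]
    fin_cases i <;> fin_cases j <;> simp <;> field_simp <;> ring
  · refine mem_iUnion.2 ⟨sym (i + 2), side i ((t - (1 + α) / 2) / ((1 - α) / 2)),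
      ⟨_, ⟨div_nonneg (by linarith) hs.le, (div_le_one hs).2 (by linarith [ht.2])⟩, rfl⟩, ?_⟩
    refine bary_ext fun j => ?_
    rw [bary_G_sym, bary_side, bary_side]
    fin_cases i <;> fin_cases j <;> simp <;> field_simp <;> ring

theorem wordMap_mem_K (hα : α ∈ Ioo (0 : ℝ) (1 / 3)) : ∀ (n : ℕ) (w : Fin n → Fin 3) {x : Plane},
    x ∈ K α hα → wordMap α n w x ∈ K α hα := by
  intro n
  induction n with
  | zero => intro w x hx; exact hx
  | succ n ih => intro w x hx; exact G_mem_K hα _ (ih _ hx)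

/-- The endpoints of a segment are vertices of cells one level deeper, so the open segments may be
replaced by closed ones. -/
theorem mem_VStar_iff {x : Plane} : x ∈ VStar α ↔
    (∃ (n : ℕ) (w : Fin n → Fin 3) (j : Fin 3), wordMap α n w (p (sym j)) = x) ∨
    ∃ (m : ℕ) (w : Fin m → Fin 3) (i : Fin 3), ∃ t ∈ Icc (0 : ℝ) 1, segParam α m w i t = x := by
  have hvert : ∀ (n : ℕ) (w : Fin n → Fin 3) (j : Fin 3), wordMap α n w (p (sym j)) ∈ VStar α := by
    intro n w j
    refine mem_iUnion.2 ⟨n, Or.inl (mem_iUnion.2 ⟨w, mem_image_of_mem _ ?_⟩)⟩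
    fin_cases j <;> simp [sym]
  constructor
  · intro hx
    obtain ⟨n, hx | hx⟩ := mem_iUnion.1 hx
    · obtain ⟨w, y, hy, rfl⟩ := mem_iUnion.1 hx
      left
      rcases hy with rfl | rfl | rfl
      exacts [⟨n, w, 0, rfl⟩, ⟨n, w, 1, rfl⟩, ⟨n, w, 2, rfl⟩]
    · right
      obtain ⟨m, -, w, y, hy, rfl⟩ := by simpa only [J, mem_iUnion, exists_prop] using hx
      obtain ⟨i, hy⟩ := mem_iUnion.1 hy
      rw [openSegment_eq_image_lineMap] at hy
      obtain ⟨t, ht, rfl⟩ := hy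
      exact ⟨m, w, i, t, Ioo_subset_Icc_self ht, segParam_eq α m w i t⟩
  · rintro (⟨n, w, j, rfl⟩ | ⟨m, w, i, t, ht, rfl⟩)
    · exact hvert n w j
    · rcases eq_or_lt_of_le ht.1 with rfl | h0
      · have := hvert (m + 1) (Fin.snoc w (i + 1)) (i + 2)
        rw [wordMap_snoc] at this
        simpa [segParam, segA, segB] using this
      rcases eq_or_lt_of_le ht.2 with rfl | h1
      · have := hvert (m + 1) (Fin.snoc w (i + 2)) (i + 1)
        rw [wordMap_snoc] at this
        simpa [segParam, segA, segB] using this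
      · refine mem_iUnion.2 ⟨m + 1, Or.inr ?_⟩
        simp only [J, mem_iUnion, exists_prop]
        refine ⟨m, by simp, w, seg α i t, mem_iUnion.2 ⟨i, ?_⟩, (segParam_eq α m w i t).symm⟩
        rw [openSegment_eq_image_lineMap]
        exact ⟨t, ⟨h0, h1⟩, rfl⟩

theorem wordMap_vertex_mem_VStar (n : ℕ) (w : Fin n → Fin 3) (j : Fin 3) :
    wordMap α n w (p (sym j)) ∈ VStar α := mem_VStar_iff.2 (Or.inl ⟨n, w, j, rfl⟩)

theorem segParam_mem_VStar (m : ℕ) (w : Fin m → Fin 3) (i : Fin 3) {t : ℝ}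
    (ht : t ∈ Icc (0 : ℝ) 1) : segParam α m w i t ∈ VStar α :=
  mem_VStar_iff.2 (Or.inr ⟨m, w, i, t, ht, rfl⟩)

theorem VStar_subset_K (hα : α ∈ Ioo (0 : ℝ) (1 / 3)) : VStar α ⊆ K α hα := by
  intro x hx
  rcases mem_VStar_iff.1 hx with ⟨n, w, j, rfl⟩ | ⟨m, w, i, t, ht, rfl⟩
  · exact wordMap_mem_K hα n w (vertex_mem_K hα j)
  · rw [segParam_eq, ← G_mid_side]
    exact wordMap_mem_K hα m w (G_mem_K hα _ (side_mem_K hα i ht))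

theorem G_sym_mem_VStar (i : Fin 3) {x : Plane} (hx : x ∈ VStar α) : G α (sym i) x ∈ VStar α := by
  rcases mem_VStar_iff.1 hx with ⟨n, w, j, rfl⟩ | ⟨m, w, j, t, ht, rfl⟩
  · have := wordMap_vertex_mem_VStar (α := α) (n + 1) (Fin.cons i w) j
    rwa [wordMap_cons] at this
  · have := segParam_mem_VStar (α := α) (m + 1) (Fin.cons i w) j ht
    rwa [segParam_eq, wordMap_cons, Function.comp_apply, ← segParam_eq] at this

/-- `V_*` is invariant under all six maps: the degenerate ones send the whole triangle into the
closed level-0 segments. -/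
theorem K_subset_closure_VStar (hα : α ∈ Ioo (0 : ℝ) (1 / 3)) : K α hα ⊆ closure (VStar α) := by
  refine K_subset_closure_of_G hα ⟨_, wordMap_vertex_mem_VStar 0 Fin.elim0 0⟩ fun k x hx => ?_
  rcases eq_sym_or_eq_mid k with ⟨i, rfl⟩ | ⟨i, rfl⟩
  · exact G_sym_mem_VStar i hx
  · rw [G_mid]
    have := segParam_mem_VStar (α := α) 0 Fin.elim0 i
      (param_mem_Icc i (K_subset_tri hα (VStar_subset_K hα hx)))
    rwa [segParam_eq] at this

/-- `K` is covered by the cells of level `n` and the closed segments of `J_n`. -/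
theorem mem_cell_or_mem_seg (hα : α ∈ Ioo (0 : ℝ) (1 / 3)) : ∀ (n : ℕ) {x : Plane}, x ∈ K α hα →
    (∃ w : Fin n → Fin 3, x ∈ wordMap α n w '' tri) ∨
    ∃ m < n, ∃ (w : Fin m → Fin 3) (i : Fin 3), x ∈ segParam α m w i '' Icc 0 1 := by
  intro n
  induction n with
  | zero => intro x hx; exact Or.inl ⟨Fin.elim0, x, K_subset_tri hα hx, rfl⟩
  | succ n ih =>
    intro x hx
    rw [K_eq] at hx
    obtain ⟨k, y, hy, rfl⟩ := mem_iUnion.1 hx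
    rcases eq_sym_or_eq_mid k with ⟨i, rfl⟩ | ⟨i, rfl⟩
    · rcases ih hy with ⟨w, z, hz, rfl⟩ | ⟨m, hm, w, j, t, ht, rfl⟩
      · exact Or.inl ⟨Fin.cons i w, z, hz, by rw [wordMap_cons]; rfl⟩
      · refine Or.inr ⟨m + 1, by omega, Fin.cons i w, j, t, ht, ?_⟩
        rw [segParam_eq, wordMap_cons, segParam_eq]
        rfl
    · rw [G_mid]
      exact Or.inr ⟨0, by omega, Fin.elim0, i, _, param_mem_Icc i (K_subset_tri hα hy),
        segParam_eq _ _ _ _ _⟩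

/-- Pulls points of `V_*` in a cell back to `V_*`, so that `OscBound`, stated for a point and all
its images, applies to every point of `V_*` in the cell. -/
theorem mem_VStar_of_G_sym_mem (hα : α ∈ Ioo (0 : ℝ) (1 / 3)) {i : Fin 3} {z : Plane}
    (hz : z ∈ tri) (h : G α (sym i) z ∈ VStar α) : z ∈ VStar α := by
  have h0 := hα.1
  have h1 := hα.2
  have hv : ∀ j, p (sym j) ∈ VStar α := fun j => wordMap_vertex_mem_VStar 0 Fin.elim0 j
  -- A level-0 segment reaches this value of coordinate `i` only at an endpoint, which is the image
  -- of a vertex.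
  have hb : (1 + α) / 2 ≤ bary i (G α (sym i) z) := by
    rw [bary_G_sym, if_pos rfl]
    nlinarith [hz i]
  rcases mem_VStar_iff.1 h with ⟨n, w, j, e⟩ | ⟨m, w, j, t, ht, e⟩
  · rcases n with _ | n
    · change p (sym j) = _ at e
      rw [← G_sym_vertex α j] at e
      rw [← (eq_of_G_sym_eq hα (vertex_mem_tri j) hz e).2]
      exact hv j
    · rw [← (eq_of_G_sym_eq hα (wordMap_mem_tri hα n _ (vertex_mem_tri j)) hz e).2]
      exact wordMap_vertex_mem_VStar _ _ _
  · rw [segParam_eq] at e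
    rcases m with _ | m
    · change seg α j t = _ at e
      rw [← e, bary_seg] at hb
      by_cases hj1 : i = j + 1
      · have hj2 : i ≠ j + 2 := by
          rw [hj1]
          exact (by decide : ∀ j : Fin 3, j + 1 ≠ j + 2) j
        rw [if_pos hj1, if_neg hj2] at hb
        have ht0 : t = 0 := by nlinarith [ht.1]
        have e' : segA α j = G α (sym i) z := by
          rw [← e, ht0, seg, AffineMap.lineMap_apply_zero]
        rw [← (eq_of_G_sym_eq hα (vertex_mem_tri _) hz e').2]
        exact hv _
      · rw [if_neg hj1] at hb
        by_cases hj2 : i = j + 2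
        · rw [if_pos hj2] at hb
          have ht1 : t = 1 := by nlinarith [ht.2]
          have e' : segB α j = G α (sym i) z := by
            rw [← e, ht1, seg, AffineMap.lineMap_apply_one]
          rw [← (eq_of_G_sym_eq hα (vertex_mem_tri _) hz e').2]
          exact hv _
        · rw [if_neg hj2] at hb
          linarith
    · rw [← (eq_of_G_sym_eq hα (wordMap_mem_tri hα m _ (seg_mem_tri hα j ht)) hz e).2,
        ← segParam_eq]
      exact segParam_mem_VStar _ _ _ ht

theorem mem_VStar_of_wordMap_mem (hα : α ∈ Ioo (0 : ℝ) (1 / 3)) : ∀ (n : ℕ) (w : Fin n → Fin 3)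
    {z : Plane}, z ∈ tri → wordMap α n w z ∈ VStar α → z ∈ VStar α := by
  intro n
  induction n with
  | zero => intro w z _ h; exact h
  | succ n ih =>
    intro w z hz h
    exact ih _ hz (mem_VStar_of_G_sym_mem hα (wordMap_mem_tri hα n _ hz) h)

/-! ### The level energies -/

/-- The bilinear form of the discrete energy. -/
def discreteForm (α : ℝ) (n : ℕ) (f g : Plane → ℝ) : ℝ :=
  ∑ w : Fin n → Fin 3, ∑ i : Fin 3,
    (f (wordMap α n w (p (sym (i + 1)))) - f (wordMap α n w (p (sym (i + 2))))) *
      (g (wordMap α n w (p (sym (i + 1)))) - g (wordMap α n w (p (sym (i + 2)))))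

/-- The bilinear form of the continuous energy. -/
def continuousForm (α : ℝ) (m : ℕ) (f g : Plane → ℝ) : ℝ :=
  ∑ w : Fin m → Fin 3, ∑ i : Fin 3, dirichlet (f ∘ segParam α m w i) (g ∘ segParam α m w i)

/-- The bilinear form of the level energy. -/
def levelForm (α : ℝ) (n : ℕ) (f g : Plane → ℝ) : ℝ :=
  (rhoD α n)⁻¹ * discreteForm α n f g
    + ∑ m ∈ Finset.range n, (rhoC α m)⁻¹ * continuousForm α m f g

theorem discreteForm_self (n : ℕ) (f : Plane → ℝ) :
    discreteForm α n f f = discreteEnergy α n f := by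
  simp only [discreteForm, discreteEnergy, sq]

theorem continuousForm_self (m : ℕ) (f : Plane → ℝ) :
    continuousForm α m f f = continuousEnergy α m f := by
  simp only [continuousForm, continuousEnergy, dirichlet_self]

theorem levelForm_self (n : ℕ) (f : Plane → ℝ) : levelForm α n f f = levelEnergy α n f := by
  simp only [levelForm, levelEnergy, discreteForm_self, continuousForm_self]

theorem InLevelDomain.congr {n : ℕ} {f g : Plane → ℝ} (hf : InLevelDomain α n f)
    (h : EqOn f g (VStar α)) : InLevelDomain α n g := fun m hm w i =>
  (hf m hm w i).congr fun _ ht => h (segParam_mem_VStar m w i ht)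

theorem levelForm_congr (n : ℕ) {f f' g g' : Plane → ℝ} (h : EqOn f f' (VStar α))
    (h' : EqOn g g' (VStar α)) : levelForm α n f g = levelForm α n f' g' := by
  have hd : discreteForm α n f g = discreteForm α n f' g' := by
    simp only [discreteForm, h (wordMap_vertex_mem_VStar _ _ _),
      h' (wordMap_vertex_mem_VStar _ _ _)]
  have hc : ∀ m, continuousForm α m f g = continuousForm α m f' g' := fun m =>
    Finset.sum_congr rfl fun w _ => Finset.sum_congr rfl fun i _ =>
      dirichlet_congr (fun _ ht => h (segParam_mem_VStar m w i ht))
        (fun _ ht => h' (segParam_mem_VStar m w i ht))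
  simp only [levelForm, hd, hc]

theorem levelEnergy_congr (n : ℕ) {f g : Plane → ℝ} (h : EqOn f g (VStar α)) :
    levelEnergy α n f = levelEnergy α n g := by
  rw [← levelForm_self, ← levelForm_self, levelForm_congr n h h]

theorem levelForm_comm (n : ℕ) (f g : Plane → ℝ) : levelForm α n f g = levelForm α n g f := by
  simp only [levelForm, discreteForm, continuousForm, dirichlet_comm (f ∘ _), mul_comm (f _ - f _)]

theorem InLevelDomain.add {n : ℕ} {f g : Plane → ℝ} (hf : InLevelDomain α n f)
    (hg : InLevelDomain α n g) : InLevelDomain α n (f + g) := fun m hm w i =>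
  (hf m hm w i).add (hg m hm w i)

theorem InLevelDomain.const_smul {n : ℕ} {f : Plane → ℝ} (hf : InLevelDomain α n f) (c : ℝ) :
    InLevelDomain α n (c • f) := fun m hm w i => (hf m hm w i).const_smul c

theorem InLevelDomain.sub {n : ℕ} {f g : Plane → ℝ} (hf : InLevelDomain α n f)
    (hg : InLevelDomain α n g) : InLevelDomain α n (f - g) := fun m hm w i =>
  (hf m hm w i).sub (hg m hm w i)

theorem levelForm_add_left {n : ℕ} {f g h : Plane → ℝ} (hf : InLevelDomain α n f)
    (hg : InLevelDomain α n g) (hh : InLevelDomain α n h) :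
    levelForm α n (f + g) h = levelForm α n f h + levelForm α n g h := by
  have hd : discreteForm α n (f + g) h = discreteForm α n f h + discreteForm α n g h := by
    simp only [discreteForm, ← Finset.sum_add_distrib, Pi.add_apply]
    refine Finset.sum_congr rfl fun w _ => Finset.sum_congr rfl fun i _ => ?_
    ring
  have hc : ∀ m ∈ Finset.range n, (rhoC α m)⁻¹ * continuousForm α m (f + g) h
      = (rhoC α m)⁻¹ * continuousForm α m f h + (rhoC α m)⁻¹ * continuousForm α m g h := by
    intro m hm
    have hm' := Finset.mem_range.1 hm
    rw [← mul_add]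
    congr 1
    simp only [continuousForm, ← Finset.sum_add_distrib]
    exact Finset.sum_congr rfl fun w _ => Finset.sum_congr rfl fun i _ =>
      dirichlet_add_left (hf m hm' w i) (hg m hm' w i) (hh m hm' w i)
  rw [levelForm, hd, Finset.sum_congr rfl hc, Finset.sum_add_distrib, levelForm, levelForm]
  ring

theorem levelForm_smul_left (n : ℕ) (c : ℝ) (f h : Plane → ℝ) :
    levelForm α n (c • f) h = c * levelForm α n f h := by
  have hd : discreteForm α n (c • f) h = c * discreteForm α n f h := by
    simp only [discreteForm, Finset.mul_sum, Pi.smul_apply, smul_eq_mul]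
    refine Finset.sum_congr rfl fun w _ => Finset.sum_congr rfl fun i _ => ?_
    ring
  have hc : ∀ m, continuousForm α m (c • f) h = c * continuousForm α m f h := by
    intro m
    simp only [continuousForm, Finset.mul_sum]
    exact Finset.sum_congr rfl fun w _ => Finset.sum_congr rfl fun i _ =>
      dirichlet_smul_left c _ _
  simp only [levelForm, hd, hc, mul_add, Finset.mul_sum]
  congr 1
  · ring
  · exact Finset.sum_congr rfl fun m _ => by ring

theorem levelForm_add_right {n : ℕ} {f g h : Plane → ℝ} (hf : InLevelDomain α n f)
    (hg : InLevelDomain α n g) (hh : InLevelDomain α n h) :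
    levelForm α n h (f + g) = levelForm α n h f + levelForm α n h g := by
  rw [levelForm_comm, levelForm_add_left hf hg hh, levelForm_comm n f, levelForm_comm n g]

theorem levelEnergy_add {n : ℕ} {f g : Plane → ℝ} (hf : InLevelDomain α n f)
    (hg : InLevelDomain α n g) :
    levelEnergy α n (f + g) = levelEnergy α n f + 2 * levelForm α n f g + levelEnergy α n g := by
  simp only [← levelForm_self]
  rw [levelForm_add_left hf hg (hf.add hg), levelForm_add_right hf hg hf,
    levelForm_add_right hf hg hg, levelForm_comm n g f]
  ring

theorem levelEnergy_smul (n : ℕ) (c : ℝ) (f : Plane → ℝ) :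
    levelEnergy α n (c • f) = c ^ 2 * levelEnergy α n f := by
  simp only [← levelForm_self]
  rw [levelForm_smul_left, levelForm_comm, levelForm_smul_left]
  ring

theorem d_succ_pos (hα : α ∈ Ioo (0 : ℝ) (1 / 3)) (n : ℕ) : 0 < d α (n + 1) := by
  have h0 := hα.1
  have h1 : 0 < (1 - α) / 2 := by linarith [hα.2]
  simp only [d]
  positivity

theorem rD_pos (hα : α ∈ Ioo (0 : ℝ) (1 / 3)) (n : ℕ) : 0 < rD α (n + 1) := by
  have := d_succ_pos hα n
  rw [rD]
  positivity

theorem rC_pos (hα : α ∈ Ioo (0 : ℝ) (1 / 3)) (n : ℕ) : 0 < rC α (n + 1) := by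
  have := d_succ_pos hα n
  rw [rC]
  positivity

theorem rhoD_pos (hα : α ∈ Ioo (0 : ℝ) (1 / 3)) (n : ℕ) : 0 < rhoD α n :=
  Finset.prod_pos fun i _ => rD_pos hα i

theorem rhoC_pos (hα : α ∈ Ioo (0 : ℝ) (1 / 3)) (n : ℕ) : 0 < rhoC α n :=
  mul_pos (rhoD_pos hα n) (rC_pos hα n)

/-- Each factor is below `3 / 5`, hence below `(4 / 5) ^ 2`; the perfect square makes the later
square roots explicit. -/
theorem rhoD_le (hα : α ∈ Ioo (0 : ℝ) (1 / 3)) (n : ℕ) : rhoD α n ≤ ((4 / 5) ^ n) ^ 2 := by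
  rw [← pow_mul, mul_comm, pow_mul]
  induction n with
  | zero => simp [rhoD]
  | succ n ih =>
    have h1 : rD α (n + 1) ≤ (4 / 5) ^ 2 := by
      have := d_succ_pos hα n
      rw [rD, div_le_iff₀ (by positivity)]
      linarith
    rw [rhoD, Finset.prod_range_succ, pow_succ]
    exact mul_le_mul ih h1 (rD_pos hα n).le (by positivity)

theorem rhoC_le (hα : α ∈ Ioo (0 : ℝ) (1 / 3)) (n : ℕ) : rhoC α n ≤ ((4 / 5) ^ n) ^ 2 := by
  refine le_trans ?_ (rhoD_le hα n)
  refine mul_le_of_le_one_right (rhoD_pos hα n).le ?_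
  have := d_succ_pos hα n
  rw [rC, div_le_one (by positivity)]
  linarith

theorem discreteEnergy_nonneg (n : ℕ) (f : Plane → ℝ) : 0 ≤ discreteEnergy α n f :=
  Finset.sum_nonneg fun _ _ => Finset.sum_nonneg fun _ _ => sq_nonneg _

theorem continuousEnergy_nonneg (m : ℕ) (f : Plane → ℝ) : 0 ≤ continuousEnergy α m f := by
  rw [← continuousForm_self]
  exact Finset.sum_nonneg fun _ _ => Finset.sum_nonneg fun _ _ => dirichlet_self_nonneg _

theorem continuousTerm_nonneg (hα : α ∈ Ioo (0 : ℝ) (1 / 3)) (m : ℕ) (f : Plane → ℝ) :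
    0 ≤ (rhoC α m)⁻¹ * continuousEnergy α m f :=
  mul_nonneg (inv_nonneg.2 (rhoC_pos hα m).le) (continuousEnergy_nonneg m f)

theorem discreteTerm_nonneg (hα : α ∈ Ioo (0 : ℝ) (1 / 3)) (n : ℕ) (f : Plane → ℝ) :
    0 ≤ (rhoD α n)⁻¹ * discreteEnergy α n f :=
  mul_nonneg (inv_nonneg.2 (rhoD_pos hα n).le) (discreteEnergy_nonneg n f)

theorem levelEnergy_nonneg (hα : α ∈ Ioo (0 : ℝ) (1 / 3)) (n : ℕ) (f : Plane → ℝ) :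
    0 ≤ levelEnergy α n f :=
  add_nonneg (discreteTerm_nonneg hα n f)
    (Finset.sum_nonneg fun m _ => continuousTerm_nonneg hα m f)

/-- `ℰ_n[f + g] ≤ 2 ℰ_n[f] + 2 ℰ_n[g]`. -/
theorem levelEnergy_add_le (hα : α ∈ Ioo (0 : ℝ) (1 / 3)) {n : ℕ} {f g : Plane → ℝ}
    (hf : InLevelDomain α n f) (hg : InLevelDomain α n g) :
    levelEnergy α n (f + g) ≤ 2 * levelEnergy α n f + 2 * levelEnergy α n g := by
  have h1 := levelEnergy_add hf hg
  -- Parallelogram law: the energy of the difference is dropped.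
  have h2 := levelEnergy_add hf (hg.const_smul (-1))
  rw [levelForm_comm, levelForm_smul_left, levelEnergy_smul, levelForm_comm] at h2
  have h3 := levelEnergy_nonneg hα n (f + (-1 : ℝ) • g)
  linarith

/-! ### Monotonicity -/

/-- One step of the energy renormalisation on a single triangle: `x j i` is the value at the vertex
`i` of the subtriangle `j`. -/
theorem triangle_energy_le {δ : ℝ} (hδ : 0 < δ) (x : Fin 3 → Fin 3 → ℝ) :
    ∑ i : Fin 3, (x (i + 1) (i + 1) - x (i + 2) (i + 2)) ^ 2
      ≤ (3 / (5 + 3 * δ))⁻¹ * ∑ j : Fin 3, ∑ i : Fin 3, (x j (i + 1) - x j (i + 2)) ^ 2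
        + (3 * δ / (5 + 3 * δ))⁻¹ *
          ∑ i : Fin 3, (x (i + 2) (i + 1) - x (i + 1) (i + 2)) ^ 2 := by
  obtain ⟨h, hh⟩ : ∃ h : Fin 3 → Fin 3 → Fin 3 → ℝ, h = fun i j k => x i j -
    -- The fraction is the energy-minimising value, given the corners, at the vertex of subtriangle
    -- `i` facing corner `j`. Thus `h` is the deviation from the minimiser, and `key` splits the
    -- energy into that of the corners plus that of `h`.
    ((2 + 3 * δ) * x i i + 2 * x j j + x k k) / (5 + 3 * δ) := ⟨_, rfl⟩
  have hD : 5 + 3 * δ ≠ 0 := by positivity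
  have key : (3 / (5 + 3 * δ))⁻¹ * ∑ j : Fin 3, ∑ i : Fin 3, (x j (i + 1) - x j (i + 2)) ^ 2
        + (3 * δ / (5 + 3 * δ))⁻¹ *
          ∑ i : Fin 3, (x (i + 2) (i + 1) - x (i + 1) (i + 2)) ^ 2
      = ∑ i : Fin 3, (x (i + 1) (i + 1) - x (i + 2) (i + 2)) ^ 2
        + (5 + 3 * δ) / 3 *
          ((h 0 1 2 - h 0 2 1) ^ 2 + h 0 1 2 ^ 2 + h 0 2 1 ^ 2
            + ((h 1 2 0 - h 1 0 2) ^ 2 + h 1 2 0 ^ 2 + h 1 0 2 ^ 2)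
            + ((h 2 0 1 - h 2 1 0) ^ 2 + h 2 0 1 ^ 2 + h 2 1 0 ^ 2))
        + (5 + 3 * δ) / (3 * δ) * ((h 0 1 2 - h 1 0 2) ^ 2 + (h 1 2 0 - h 2 1 0) ^ 2
            + (h 2 0 1 - h 0 2 1) ^ 2) := by
    simp only [hh, Fin.sum_univ_three, Fin.isValue, Fin.reduceAdd, zero_add]
    generalize x 0 0 = a0, x 0 1 = a1, x 0 2 = a2, x 1 0 = b0, x 1 1 = b1, x 1 2 = b2,
      x 2 0 = c0, x 2 1 = c1, x 2 2 = c2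
    field_simp
    ring
  rw [key]
  have : 0 ≤ (5 + 3 * δ) / 3 := by positivity
  have : 0 ≤ (5 + 3 * δ) / (3 * δ) := by positivity
  rw [add_assoc]
  refine le_add_of_nonneg_right ?_
  positivity

theorem sum_word_succ (n : ℕ) (F : (Fin (n + 1) → Fin 3) → ℝ) :
    ∑ w, F w = ∑ w : Fin n → Fin 3, ∑ j : Fin 3, F (Fin.snoc w j : Fin (n + 1) → Fin 3) := by
  rw [← (Fin.snocEquiv fun _ : Fin (n + 1) => Fin 3).sum_comp, Fintype.sum_prod_type_right]
  rfl

/-- Applies `triangle_energy_le` in each cell, after bounding the squared jump across each segment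
by its Dirichlet integral. -/
theorem discreteEnergy_le (hα : α ∈ Ioo (0 : ℝ) (1 / 3)) {n : ℕ} {f : Plane → ℝ}
    (hf : InLevelDomain α (n + 1) f) :
    discreteEnergy α n f ≤ (rD α (n + 1))⁻¹ * discreteEnergy α (n + 1) f
      + (rC α (n + 1))⁻¹ * continuousEnergy α n f := by
  rw [discreteEnergy, discreteEnergy, sum_word_succ, ← continuousForm_self, continuousForm,
    Finset.mul_sum, Finset.mul_sum, ← Finset.sum_add_distrib]
  refine Finset.sum_le_sum fun w _ => ?_
  have h := triangle_energy_le (d_succ_pos hα n)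
    fun j i => f (wordMap α n w (G α (sym j) (p (sym i))))
  simp only [G_sym_vertex] at h
  simp only [wordMap_snoc, Function.comp_apply]
  refine h.trans ?_
  rw [rD, rC]
  gcongr with i _
  · rw [inv_nonneg]
    exact (rC_pos hα n).le
  have := (hf n (Nat.lt_succ_self n) w i).sq_sub_le (left_mem_Icc.2 zero_le_one)
    (right_mem_Icc.2 zero_le_one)
  simpa [segParam, segA, segB] using this

theorem levelEnergy_le_succ (hα : α ∈ Ioo (0 : ℝ) (1 / 3)) {n : ℕ} {f : Plane → ℝ}
    (hf : InLevelDomain α (n + 1) f) : levelEnergy α n f ≤ levelEnergy α (n + 1) f := by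
  have h := mul_le_mul_of_nonneg_left (discreteEnergy_le hα hf) (inv_nonneg.2 (rhoD_pos hα n).le)
  have e : rhoD α (n + 1) = rhoD α n * rD α (n + 1) := Finset.prod_range_succ _ _
  rw [levelEnergy, levelEnergy, Finset.sum_range_succ, e, rhoC, mul_inv, mul_inv]
  linarith

theorem monotone_levelEnergy (hα : α ∈ Ioo (0 : ℝ) (1 / 3)) {f : Plane → ℝ}
    (hf : ∀ n, InLevelDomain α n f) : Monotone fun n => levelEnergy α n f :=
  monotone_nat_of_le_succ fun n => levelEnergy_le_succ hα (hf (n + 1))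

/-! ### Oscillation on cells -/

theorem abs_sub_vertex_le (hα : α ∈ Ioo (0 : ℝ) (1 / 3)) {f : Plane → ℝ} {E : ℝ}
    (n : ℕ) (hE : levelEnergy α n f ≤ E) (w : Fin n → Fin 3) (i j : Fin 3) :
    |f (wordMap α n w (p (sym i))) - f (wordMap α n w (p (sym j)))| ≤ (4 / 5) ^ n * √E := by
  have hE0 : 0 ≤ E := (levelEnergy_nonneg hα n f).trans hE
  have hdisc : discreteEnergy α n f ≤ ((4 / 5) ^ n) ^ 2 * E := by
    have h1 : (rhoD α n)⁻¹ * discreteEnergy α n f ≤ E :=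
      (le_add_of_nonneg_right (Finset.sum_nonneg fun m _ => continuousTerm_nonneg hα m f)).trans hE
    rw [inv_mul_le_iff₀ (rhoD_pos hα n)] at h1
    exact h1.trans (mul_le_mul_of_nonneg_right (rhoD_le hα n) hE0)
  have key : ∀ k : Fin 3, |f (wordMap α n w (p (sym (k + 1)))) - f (wordMap α n w (p (sym (k + 2))))|
      ≤ (4 / 5) ^ n * √E := by
    intro k
    refine abs_le_of_sq_le_sq ?_ (by positivity)
    rw [mul_pow, Real.sq_sqrt hE0]
    refine le_trans ?_ hdisc
    refine le_trans ?_ (Finset.single_le_sum (fun w _ => Finset.sum_nonneg fun i _ => sq_nonneg _)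
      (Finset.mem_univ w))
    exact Finset.single_le_sum (f := fun i : Fin 3 =>
      (f (wordMap α n w (p (sym (i + 1)))) - f (wordMap α n w (p (sym (i + 2))))) ^ 2)
      (fun i _ => sq_nonneg _) (Finset.mem_univ k)
  rcases (by decide : ∀ i j : Fin 3, i = j ∨ (∃ k, i = k + 1 ∧ j = k + 2) ∨
    ∃ k, j = k + 1 ∧ i = k + 2) i j with rfl | ⟨k, rfl, rfl⟩ | ⟨k, rfl, rfl⟩
  · rw [sub_self, abs_zero]
    positivity
  · exact key k
  · rw [abs_sub_comm]
    exact key k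

theorem dirichlet_seg_le (hα : α ∈ Ioo (0 : ℝ) (1 / 3)) {f : Plane → ℝ} {E : ℝ} (n : ℕ)
    (hE : levelEnergy α (n + 1) f ≤ E) (w : Fin n → Fin 3) (i : Fin 3) :
    dirichlet (f ∘ segParam α n w i) (f ∘ segParam α n w i) ≤ ((4 / 5) ^ n) ^ 2 * E := by
  have hE0 : 0 ≤ E := (levelEnergy_nonneg hα _ f).trans hE
  have hcont : continuousEnergy α n f ≤ ((4 / 5) ^ n) ^ 2 * E := by
    have h1 : (rhoC α n)⁻¹ * continuousEnergy α n f ≤ E := by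
      refine le_trans ?_ hE
      refine le_add_of_nonneg_of_le (discreteTerm_nonneg hα _ f) ?_
      exact Finset.single_le_sum (f := fun m => (rhoC α m)⁻¹ * continuousEnergy α m f)
        (fun m _ => continuousTerm_nonneg hα m f) (Finset.self_mem_range_succ n)
    rw [inv_mul_le_iff₀ (rhoC_pos hα n)] at h1
    exact h1.trans (mul_le_mul_of_nonneg_right (rhoC_le hα n) hE0)
  refine le_trans ?_ hcont
  rw [← continuousForm_self]
  refine le_trans ?_ (Finset.single_le_sum (fun w _ => Finset.sum_nonneg fun i _ =>
    dirichlet_self_nonneg _) (Finset.mem_univ w))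
  exact Finset.single_le_sum
    (f := fun i : Fin 3 => dirichlet (f ∘ segParam α n w i) (f ∘ segParam α n w i))
    (fun i _ => dirichlet_self_nonneg _) (Finset.mem_univ i)

theorem abs_sub_seg_le (hα : α ∈ Ioo (0 : ℝ) (1 / 3)) {f : Plane → ℝ} {E : ℝ} (n : ℕ)
    (hf : InLevelDomain α (n + 1) f) (hE : levelEnergy α (n + 1) f ≤ E) (w : Fin n → Fin 3)
    (i : Fin 3) {t : ℝ} (ht : t ∈ Icc (0 : ℝ) 1) :
    |f (wordMap α n w (seg α i t)) - f (wordMap α n w (segA α i))| ≤ (4 / 5) ^ n * √E := by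
  have h0 : segA α i = seg α i 0 := by rw [seg, AffineMap.lineMap_apply_zero]
  rw [h0, ← segParam_eq, ← segParam_eq]
  refine abs_le_of_sq_le_sq ?_ (by positivity)
  rw [mul_pow, Real.sq_sqrt ((levelEnergy_nonneg hα _ f).trans hE)]
  exact ((hf n (Nat.lt_succ_self n) w i).sq_sub_le (left_mem_Icc.2 zero_le_one) ht).trans
    (dirichlet_seg_le hα n hE w i)

/-- On each cell, the value at (the image of) `y` differs from those at the vertices by at most
`C (4/5)^n S`. -/
def OscBound (α : ℝ) (f : Plane → ℝ) (S C : ℝ) (y : Plane) : Prop :=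
  ∀ (n : ℕ) (w : Fin n → Fin 3) (k : Fin 3),
    |f (wordMap α n w y) - f (wordMap α n w (p (sym k)))| ≤ C * ((4 / 5) ^ n * S)

/-- Going through the vertex `p i`, fixed by the map, costs `C * (4 / 5) ^ (n + 1) + (4 / 5) ^ n`,
which is at most `C * (4 / 5) ^ n` exactly when `5 ≤ C`. -/
theorem OscBound.G_sym {f : Plane → ℝ} {S C : ℝ} {y : Plane} (hS : 0 ≤ S) (hC : 5 ≤ C)
    (hv : ∀ j, OscBound α f S 1 (p (sym j))) (h : OscBound α f S C y) (i : Fin 3) :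
    OscBound α f S C (G α (sym i) y) := by
  intro n w k
  have h1 := h (n + 1) (Fin.snoc w i) i
  have h2 := hv i n w k
  rw [wordMap_snoc, Function.comp_apply, Function.comp_apply, G_sym_vertex, pow_succ] at h1
  have h3 := abs_sub_le (f (wordMap α n w (G α (sym i) y))) (f (wordMap α n w (p (sym i))))
    (f (wordMap α n w (p (sym k))))
  have h4 : 0 ≤ (4 / 5 : ℝ) ^ n * S := by positivity
  nlinarith

theorem OscBound.wordMap {f : Plane → ℝ} {S C : ℝ} {y : Plane} (hS : 0 ≤ S) (hC : 5 ≤ C)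
    (hv : ∀ j, OscBound α f S 1 (p (sym j))) (h : OscBound α f S C y) :
    ∀ (n : ℕ) (w : Fin n → Fin 3), OscBound α f S C (wordMap α n w y) := by
  intro n
  induction n with
  | zero => intro w; exact h
  | succ n ih => intro w; exact OscBound.G_sym hS hC hv (ih _) _

theorem OscBound.mono {f : Plane → ℝ} {S C C' : ℝ} {y : Plane} (hS : 0 ≤ S) (hC : C ≤ C')
    (h : OscBound α f S C y) : OscBound α f S C' y := fun n w k =>
  (h n w k).trans (mul_le_mul_of_nonneg_right hC (by positivity))

/-- The oscillation estimate on cells. -/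
theorem oscBound_of_mem_VStar (hα : α ∈ Ioo (0 : ℝ) (1 / 3)) {f : Plane → ℝ} {E : ℝ}
    (hf : ∀ n, InLevelDomain α n f) (hE : ∀ n, levelEnergy α n f ≤ E) {x : Plane}
    (hx : x ∈ VStar α) : OscBound α f √E 6 x := by
  have hS : 0 ≤ √E := Real.sqrt_nonneg E
  have hv : ∀ j, OscBound α f √E 1 (p (sym j)) := fun j n w k => by
    rw [one_mul]
    exact abs_sub_vertex_le hα n (hE n) w j k
  rcases mem_VStar_iff.1 hx with ⟨n, w, j, rfl⟩ | ⟨m, w, i, t, ht, rfl⟩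
  · exact ((hv j).mono hS (by norm_num)).wordMap hS (by norm_num) hv n w
  · rw [segParam_eq]
    refine OscBound.wordMap hS (by norm_num) hv ?_ m w
    intro n w k
    -- The constant 6 is 1 for moving along the segment to its endpoint `segA`, plus 5 for that
    -- endpoint, a vertex of a subcell.
    have h1 := abs_sub_seg_le hα n (hf (n + 1)) (hE (n + 1)) w i ht
    have h2 := ((hv (i + 2)).mono hS (by norm_num : (1 : ℝ) ≤ 5)).G_sym hS le_rfl hv (i + 1) n w k
    have h3 := abs_sub_le (f (Hanoi.wordMap α n w (seg α i t)))
      (f (Hanoi.wordMap α n w (segA α i))) (f (Hanoi.wordMap α n w (p (sym k))))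
    rw [segA] at h1 h3
    linarith

/-! ### Continuous extension -/

theorem segA_ne_segB (hα : α ∈ Ioo (0 : ℝ) (1 / 3)) (i : Fin 3) : segA α i ≠ segB α i := by
  intro h
  have h1 := bary_seg α i (i + 1) 0
  have h2 := bary_seg α i (i + 1) 1
  rw [seg, AffineMap.lineMap_apply_zero] at h1
  rw [seg, AffineMap.lineMap_apply_one, ← h, h1] at h2
  simp at h2
  linarith [hα.1]

theorem continuousWithinAt_seg (hα : α ∈ Ioo (0 : ℝ) (1 / 3)) {f : Plane → ℝ} {m : ℕ}
    {w : Fin m → Fin 3} {i : Fin 3} (hf : IsH1 (f ∘ segParam α m w i)) {x : Plane}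
    (hx : x ∈ segParam α m w i '' Icc 0 1) :
    ContinuousWithinAt f (segParam α m w i '' Icc 0 1) x := by
  obtain ⟨t, ht, rfl⟩ := hx
  have hL : 0 < dist (wordMap α m w (segA α i)) (wordMap α m w (segB α i)) := by
    rw [dist_wordMap hα]
    have : 0 < (1 - α) / 2 := by linarith [hα.2]
    have := dist_pos.2 (segA_ne_segB hα i)
    positivity
  rw [Metric.continuousWithinAt_iff]
  intro ε hε
  obtain ⟨δ, hδ, H⟩ := Metric.continuousWithinAt_iff.1 (hf.continuousOn t ht) ε hε
  refine ⟨δ * dist (wordMap α m w (segA α i)) (wordMap α m w (segB α i)), by positivity, ?_⟩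
  rintro _ ⟨s, hs, rfl⟩ hd
  rw [segParam, segParam, dist_lineMap_lineMap] at hd
  exact H hs (lt_of_mul_lt_mul_right hd hL.le)

theorem isClosed_cell (hα : α ∈ Ioo (0 : ℝ) (1 / 3)) (n : ℕ) (w : Fin n → Fin 3) :
    IsClosed (wordMap α n w '' tri) := by
  have h0 : 0 ≤ (1 - α) / 2 := by linarith [hα.2]
  have : LipschitzWith (Real.toNNReal (((1 - α) / 2) ^ n)) (wordMap α n w) :=
    LipschitzWith.of_dist_le_mul fun x y => by
      rw [dist_wordMap hα, Real.coe_toNNReal _ (by positivity)]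
  exact (isCompact_tri.image this.continuous).isClosed

theorem isClosed_seg (m : ℕ) (w : Fin m → Fin 3) (i : Fin 3) :
    IsClosed (segParam α m w i '' Icc 0 1) := by
  have : Continuous (segParam α m w i) := AffineMap.lineMap_continuous
  exact (isCompact_Icc.image this).isClosed

theorem seg_subset_VStar (m : ℕ) (w : Fin m → Fin 3) (i : Fin 3) :
    segParam α m w i '' Icc 0 1 ⊆ VStar α := by
  rintro _ ⟨t, ht, rfl⟩
  exact segParam_mem_VStar m w i ht

theorem abs_sub_le_of_mem_cell (hα : α ∈ Ioo (0 : ℝ) (1 / 3)) {f : Plane → ℝ} {S : ℝ}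
    (h : ∀ x ∈ VStar α, OscBound α f S 6 x) {n : ℕ} {w : Fin n → Fin 3} {x y : Plane}
    (hx : x ∈ VStar α) (hy : y ∈ VStar α) (hxw : x ∈ wordMap α n w '' tri)
    (hyw : y ∈ wordMap α n w '' tri) : |f x - f y| ≤ 12 * ((4 / 5) ^ n * S) := by
  obtain ⟨x, hx', rfl⟩ := hxw
  obtain ⟨y, hy', rfl⟩ := hyw
  have h1 := h x (mem_VStar_of_wordMap_mem hα n w hx' hx) n w 0
  have h2 := h y (mem_VStar_of_wordMap_mem hα n w hy' hy) n w 0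
  rw [abs_sub_comm] at h2
  have := abs_sub_le (f (wordMap α n w x)) (f (wordMap α n w (p (sym 0)))) (f (wordMap α n w y))
  linarith

theorem exists_pow_mul_lt {ε : ℝ} (hε : 0 < ε) (S : ℝ) :
    ∃ n : ℕ, 12 * ((4 / 5) ^ n * S) < ε := by
  have : Tendsto (fun n : ℕ => 12 * ((4 / 5 : ℝ) ^ n * S)) atTop (𝓝 (12 * (0 * S))) :=
    ((tendsto_pow_atTop_nhds_zero_of_lt_one (by norm_num) (by norm_num)).mul_const S).const_mul 12
  rw [zero_mul, mul_zero] at this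
  exact (this.eventually_lt_const hε).exists

/-- At a level `n` where cells oscillate by less than `ε`, nearby points avoid every closed cell and
segment not containing `x`. On the others, the oscillation bound or continuity along the segment
applies. -/
theorem tendsto_of_mem_VStar (hα : α ∈ Ioo (0 : ℝ) (1 / 3)) {f : Plane → ℝ} {S : ℝ}
    (hf : ∀ n, InLevelDomain α n f) (h : ∀ x ∈ VStar α, OscBound α f S 6 x) {x : Plane}
    (hx : x ∈ VStar α) : Tendsto f (𝓝[VStar α] x) (𝓝 (f x)) := by
  rw [Metric.tendsto_nhds]
  intro ε hε
  obtain ⟨n, hn⟩ := exists_pow_mul_lt hε S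
  have hcell : ∀ᶠ y in 𝓝[VStar α] x, ∀ w : Fin n → Fin 3, y ∈ wordMap α n w '' tri →
      dist (f y) (f x) < ε := by
    rw [eventually_all]
    intro w
    by_cases hxw : x ∈ wordMap α n w '' tri
    · filter_upwards [self_mem_nhdsWithin] with y hy hyw
      exact (abs_sub_le_of_mem_cell hα h hy hx hyw hxw).trans_lt hn
    · filter_upwards [mem_nhdsWithin_of_mem_nhds ((isClosed_cell hα n w).isOpen_compl.mem_nhds hxw)]
        with y hy hyw
      exact absurd hyw hy
  have hseg : ∀ᶠ y in 𝓝[VStar α] x, ∀ m ∈ Finset.range n, ∀ (w : Fin m → Fin 3) (i : Fin 3),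
      y ∈ segParam α m w i '' Icc 0 1 → dist (f y) (f x) < ε := by
    rw [Filter.eventually_all_finset]
    intro m hm
    simp only [eventually_all]
    intro w i
    refine Filter.Eventually.filter_mono nhdsWithin_le_nhds ?_
    by_cases hxw : x ∈ segParam α m w i '' Icc 0 1
    · have := continuousWithinAt_seg hα (hf (m + 1) m (Nat.lt_succ_self m) w i) hxw
      exact eventually_nhdsWithin_iff.1 (Metric.tendsto_nhds.1 this ε hε)
    · filter_upwards [(isClosed_seg m w i).isOpen_compl.mem_nhds hxw] with y hy hyw
      exact absurd hyw hy
  filter_upwards [hcell, hseg, self_mem_nhdsWithin] with y h1 h2 hy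
  rcases mem_cell_or_mem_seg hα n (VStar_subset_K hα hy) with ⟨w, hw⟩ | ⟨m, hm, w, i, hw⟩
  · exact h1 w hw
  · exact h2 m (Finset.mem_range.2 hm) w i hw

/-- A point outside `V_*` is on no closed segment, so at each level it lies in exactly one cell.
Nearby points of `V_*` stay in that cell, and the oscillation bound gives the Cauchy property. -/
theorem exists_tendsto_of_mem_K (hα : α ∈ Ioo (0 : ℝ) (1 / 3)) {f : Plane → ℝ} {S : ℝ}
    (hf : ∀ n, InLevelDomain α n f) (h : ∀ x ∈ VStar α, OscBound α f S 6 x) {x : Plane}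
    (hx : x ∈ K α hα) : ∃ y, Tendsto f (𝓝[VStar α] x) (𝓝 y) := by
  by_cases hxV : x ∈ VStar α
  · exact ⟨_, tendsto_of_mem_VStar hα hf h hxV⟩
  have hne : (𝓝[VStar α] x).NeBot :=
    mem_closure_iff_nhdsWithin_neBot.1 (K_subset_closure_VStar hα hx)
  rw [← cauchy_map_iff_exists_tendsto, Metric.cauchy_iff]
  refine ⟨hne.map f, fun ε hε => ?_⟩
  obtain ⟨n, hn⟩ := exists_pow_mul_lt hε S
  obtain ⟨w, hw⟩ : ∃ w : Fin n → Fin 3, x ∈ wordMap α n w '' tri := by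
    rcases mem_cell_or_mem_seg hα n hx with hw | ⟨m, hm, w, i, hw⟩
    · exact hw
    · exact absurd (seg_subset_VStar m w i hw) hxV
  have hcell : ∀ᶠ y in 𝓝[VStar α] x, ∀ w' : Fin n → Fin 3, y ∈ wordMap α n w' '' tri → w' = w := by
    rw [eventually_all]
    intro w'
    by_cases hxw : x ∈ wordMap α n w' '' tri
    · refine Eventually.of_forall fun y _ => ?_
      obtain ⟨a, ha, rfl⟩ := hw
      obtain ⟨b, hb, e⟩ := hxw
      exact eq_of_wordMap_eq hα n w' w hb ha e
    · filter_upwards [mem_nhdsWithin_of_mem_nhds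
        ((isClosed_cell hα n w').isOpen_compl.mem_nhds hxw)] with y hy hyw
      exact absurd hyw hy
  have hseg : ∀ᶠ y in 𝓝[VStar α] x, ∀ m ∈ Finset.range n, ∀ (w : Fin m → Fin 3) (i : Fin 3),
      y ∉ segParam α m w i '' Icc 0 1 := by
    rw [Filter.eventually_all_finset]
    intro m hm
    simp only [eventually_all]
    intro w i
    exact mem_nhdsWithin_of_mem_nhds ((isClosed_seg m w i).isOpen_compl.mem_nhds fun hxw =>
      hxV (seg_subset_VStar m w i hxw))
  have hmem : ∀ᶠ y in 𝓝[VStar α] x, y ∈ VStar α ∧ y ∈ wordMap α n w '' tri := by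
    filter_upwards [hcell, hseg, self_mem_nhdsWithin] with y h1 h2 hy
    refine ⟨hy, ?_⟩
    rcases mem_cell_or_mem_seg hα n (VStar_subset_K hα hy) with ⟨w', hw'⟩ | ⟨m, hm, w', i, hw'⟩
    · rwa [h1 w' hw'] at hw'
    · exact absurd hw' (h2 m (Finset.mem_range.2 hm) w' i)
  refine ⟨_, image_mem_map hmem, ?_⟩
  rintro _ ⟨y, hy, rfl⟩ _ ⟨z, hz, rfl⟩
  exact (abs_sub_le_of_mem_cell hα h hy.1 hz.1 hy.2 hz.2).trans_lt hn

/-! ### The domain of the limit form -/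

theorem zeroExt_of_mem {X : Set Plane} (u : X → ℝ) {x : Plane} (hx : x ∈ X) :
    zeroExt u x = u ⟨x, hx⟩ := Subtype.val_injective.extend_apply u 0 ⟨x, hx⟩

theorem zeroExt_of_notMem {X : Set Plane} (u : X → ℝ) {x : Plane} (hx : x ∉ X) :
    zeroExt u x = 0 := Function.extend_apply' _ _ _ (by rintro ⟨y, rfl⟩; exact hx y.2)

theorem zeroExt_add {X : Set Plane} (u v : X → ℝ) : zeroExt (u + v) = zeroExt u + zeroExt v := by
  ext x
  by_cases hx : x ∈ X
  · simp only [Pi.add_apply, zeroExt_of_mem _ hx]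
  · simp only [Pi.add_apply, zeroExt_of_notMem _ hx, add_zero]

theorem zeroExt_smul {X : Set Plane} (c : ℝ) (u : X → ℝ) : zeroExt (c • u) = c • zeroExt u := by
  ext x
  by_cases hx : x ∈ X
  · simp only [Pi.smul_apply, zeroExt_of_mem _ hx]
  · simp only [Pi.smul_apply, zeroExt_of_notMem _ hx, smul_zero]

theorem zeroExt_sub {X : Set Plane} (u v : X → ℝ) : zeroExt (u - v) = zeroExt u - zeroExt v := by
  have h := zeroExt_add u ((-1 : ℝ) • v)
  rwa [zeroExt_smul, neg_one_smul, neg_one_smul, ← sub_eq_add_neg, ← sub_eq_add_neg] at h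

/-- Functions in all level domains with bounded level energies. -/
def FiniteEnergy (α : ℝ) (f : Plane → ℝ) : Prop :=
  (∀ n, InLevelDomain α n f) ∧ BddAbove (range fun n => levelEnergy α n f)

theorem FiniteEnergy.congr {f g : Plane → ℝ} (hf : FiniteEnergy α f) (h : EqOn f g (VStar α)) :
    FiniteEnergy α g := by
  refine ⟨fun n => (hf.1 n).congr h, ?_⟩
  simp only [← levelEnergy_congr _ h]
  exact hf.2

theorem FiniteEnergy.add (hα : α ∈ Ioo (0 : ℝ) (1 / 3)) {f g : Plane → ℝ} (hf : FiniteEnergy α f)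
    (hg : FiniteEnergy α g) : FiniteEnergy α (f + g) := by
  obtain ⟨a, ha⟩ := hf.2
  obtain ⟨b, hb⟩ := hg.2
  refine ⟨fun n => (hf.1 n).add (hg.1 n), 2 * a + 2 * b, ?_⟩
  rintro _ ⟨n, rfl⟩
  have h1 := ha (mem_range_self n)
  have h2 := hb (mem_range_self n)
  have := levelEnergy_add_le hα (hf.1 n) (hg.1 n)
  simp only at h1 h2 ⊢
  linarith

theorem FiniteEnergy.const_smul {f : Plane → ℝ} (hf : FiniteEnergy α f) (c : ℝ) :
    FiniteEnergy α (c • f) := by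
  obtain ⟨a, ha⟩ := hf.2
  refine ⟨fun n => (hf.1 n).const_smul c, c ^ 2 * a, ?_⟩
  rintro _ ⟨n, rfl⟩
  simp only [levelEnergy_smul]
  exact mul_le_mul_of_nonneg_left (ha (mem_range_self n)) (sq_nonneg c)

theorem FiniteEnergy.oscBound (hα : α ∈ Ioo (0 : ℝ) (1 / 3)) {f : Plane → ℝ}
    (hf : FiniteEnergy α f) : ∃ S, ∀ x ∈ VStar α, OscBound α f S 6 x := by
  obtain ⟨a, ha⟩ := hf.2
  exact ⟨√a, fun x => oscBound_of_mem_VStar hα hf.1 fun n => ha (mem_range_self n)⟩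

theorem finiteEnergy_of_mem_DStar {v : VStar α → ℝ} (hv : v ∈ DStar α) :
    FiniteEnergy α (zeroExt v) := by
  obtain ⟨h1, L, hL⟩ := hv
  exact ⟨h1, hL.bddAbove_range⟩

theorem continuous_extendToK (hα : α ∈ Ioo (0 : ℝ) (1 / 3)) {v : VStar α → ℝ} (hv : v ∈ DStar α) :
    Continuous (extendToK α hα v) := by
  have hfe := finiteEnergy_of_mem_DStar hv
  obtain ⟨S, hS⟩ := hfe.oscBound hα
  exact continuousOn_iff_continuous_domRestrict.1 (continuousOn_extendFrom
    (K_subset_closure_VStar hα) fun x hx => exists_tendsto_of_mem_K hα hfe.1 hS hx)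

theorem extendToK_of_mem (hα : α ∈ Ioo (0 : ℝ) (1 / 3)) {v : VStar α → ℝ} (hv : v ∈ DStar α)
    {x : Plane} (hx : x ∈ VStar α) (hxK : x ∈ K α hα) :
    extendToK α hα v ⟨x, hxK⟩ = v ⟨x, hx⟩ := by
  have hfe := finiteEnergy_of_mem_DStar hv
  obtain ⟨S, hS⟩ := hfe.oscBound hα
  rw [← zeroExt_of_mem v hx]
  exact extendFrom_eq (subset_closure hx) (tendsto_of_mem_VStar hα hfe.1 hS hx)

theorem tendsto_zeroExt (hα : α ∈ Ioo (0 : ℝ) (1 / 3)) {u : K α hα → ℝ} (hu : Continuous u)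
    (x : K α hα) : Tendsto (zeroExt u) (𝓝[VStar α] x) (𝓝 (u x)) := by
  have hc : ContinuousOn (zeroExt u) (K α hα) := by
    rw [continuousOn_iff_continuous_domRestrict]
    convert hu using 1
    ext y
    exact zeroExt_of_mem u y.2
  have := (hc x x.2).mono_left (nhdsWithin_mono (x : Plane) (VStar_subset_K hα))
  rwa [zeroExt_of_mem u x.2] at this

/-- Bounded increasing energies converge, and by density a continuous function is the limit
extension of its restriction to `V_*`. Later arguments can thus avoid `extendFrom`. -/
theorem mem_F_iff (hα : α ∈ Ioo (0 : ℝ) (1 / 3)) (u : K α hα → ℝ) :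
    u ∈ F α hα ↔ Continuous u ∧ FiniteEnergy α (zeroExt u) := by
  constructor
  · rintro ⟨v, hv, rfl⟩
    refine ⟨continuous_extendToK hα hv, (finiteEnergy_of_mem_DStar hv).congr fun x hx => ?_⟩
    rw [zeroExt_of_mem v hx, zeroExt_of_mem _ (VStar_subset_K hα hx), extendToK_of_mem hα hv hx]
  · rintro ⟨hc, hfe⟩
    let v : VStar α → ℝ := fun x => u ⟨x, VStar_subset_K hα x.2⟩
    have heq : EqOn (zeroExt u) (zeroExt v) (VStar α) := fun x hx => by
      rw [zeroExt_of_mem v hx, zeroExt_of_mem _ (VStar_subset_K hα hx)]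
    have hv := hfe.congr heq
    refine ⟨v, ⟨hv.1, _, tendsto_atTop_ciSup (monotone_levelEnergy hα hv.1) hv.2⟩, ?_⟩
    ext x
    exact extendFrom_eq (K_subset_closure_VStar hα x.2)
      ((tendsto_zeroExt hα hc x).congr' (heq.eventuallyEq_of_mem self_mem_nhdsWithin))

theorem F_add (hα : α ∈ Ioo (0 : ℝ) (1 / 3)) {u v : K α hα → ℝ} (hu : u ∈ F α hα)
    (hv : v ∈ F α hα) : u + v ∈ F α hα := by
  rw [mem_F_iff] at *
  rw [zeroExt_add]
  exact ⟨hu.1.add hv.1, hu.2.add hα hv.2⟩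

theorem F_smul (hα : α ∈ Ioo (0 : ℝ) (1 / 3)) (c : ℝ) {u : K α hα → ℝ} (hu : u ∈ F α hα) :
    c • u ∈ F α hα := by
  rw [mem_F_iff] at *
  rw [zeroExt_smul]
  exact ⟨hu.1.const_smul c, hu.2.const_smul c⟩

theorem F_sub (hα : α ∈ Ioo (0 : ℝ) (1 / 3)) {u v : K α hα → ℝ} (hu : u ∈ F α hα)
    (hv : v ∈ F α hα) : u - v ∈ F α hα := by
  have := F_add hα hu (F_smul hα (-1) hv)
  rwa [neg_one_smul, ← sub_eq_add_neg] at this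

theorem tendsto_energy (hα : α ∈ Ioo (0 : ℝ) (1 / 3)) {u : K α hα → ℝ} (hu : u ∈ F α hα) :
    Tendsto (fun n => levelEnergy α n (zeroExt u)) atTop (𝓝 (energy α hα u)) := by
  have h := ((mem_F_iff hα u).1 hu).2
  exact tendsto_nhds_limUnder ⟨_, tendsto_atTop_ciSup (monotone_levelEnergy hα h.1) h.2⟩

theorem levelEnergy_le_energy (hα : α ∈ Ioo (0 : ℝ) (1 / 3)) {u : K α hα → ℝ} (hu : u ∈ F α hα)
    (n : ℕ) : levelEnergy α n (zeroExt u) ≤ energy α hα u :=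
  (monotone_levelEnergy hα ((mem_F_iff hα u).1 hu).2.1).ge_of_tendsto (tendsto_energy hα hu) n

theorem energy_nonneg (hα : α ∈ Ioo (0 : ℝ) (1 / 3)) {u : K α hα → ℝ} (hu : u ∈ F α hα) :
    0 ≤ energy α hα u := (levelEnergy_nonneg hα 0 _).trans (levelEnergy_le_energy hα hu 0)

/-- Transfers symmetry and bilinearity from the level forms by uniqueness of limits. -/
theorem tendsto_form (hα : α ∈ Ioo (0 : ℝ) (1 / 3)) {u v : K α hα → ℝ} (hu : u ∈ F α hα)
    (hv : v ∈ F α hα) :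
    Tendsto (fun n => levelForm α n (zeroExt u) (zeroExt v)) atTop (𝓝 (form α hα u v)) := by
  have h := (((tendsto_energy hα (F_add hα hu hv)).sub (tendsto_energy hα hu)).sub
    (tendsto_energy hα hv)).const_mul (1 / 2)
  refine h.congr fun n => ?_
  rw [zeroExt_add, levelEnergy_add (((mem_F_iff hα u).1 hu).2.1 n) (((mem_F_iff hα v).1 hv).2.1 n)]
  ring

theorem form_self (hα : α ∈ Ioo (0 : ℝ) (1 / 3)) {u : K α hα → ℝ} (hu : u ∈ F α hα) :
    form α hα u u = energy α hα u := by
  refine tendsto_nhds_unique (tendsto_form hα hu hu) ?_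
  simp only [levelForm_self]
  exact tendsto_energy hα hu

/-- The base point `p₁` of `K`. -/
def basePoint (hα : α ∈ Ioo (0 : ℝ) (1 / 3)) : K α hα := ⟨p (sym 0), vertex_mem_K hα 0⟩

/-- The oscillation bound for the empty word, extended from `V_*` to `K` by continuity. -/
theorem abs_sub_basePoint_le (hα : α ∈ Ioo (0 : ℝ) (1 / 3)) {u : K α hα → ℝ} (hu : u ∈ F α hα)
    (x : K α hα) : |u x - u (basePoint hα)| ≤ 6 * √(energy α hα u) := by
  have hu' := (mem_F_iff hα u).1 hu
  have hne : (𝓝[VStar α] (x : Plane)).NeBot :=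
    mem_closure_iff_nhdsWithin_neBot.1 (K_subset_closure_VStar hα x.2)
  refine le_of_tendsto ((tendsto_zeroExt hα hu'.1 x).sub_const (u (basePoint hα))).abs ?_
  filter_upwards [self_mem_nhdsWithin] with y hy
  have h := oscBound_of_mem_VStar hα hu'.2.1 (levelEnergy_le_energy hα hu) hy 0 Fin.elim0 0
  rw [pow_zero, one_mul] at h
  rwa [basePoint, ← zeroExt_of_mem u]

theorem sq_abs_sub_le (hα : α ∈ Ioo (0 : ℝ) (1 / 3)) {u : K α hα → ℝ} (hu : u ∈ F α hα)
    (x y : K α hα) : |u x - u y| ^ 2 ≤ 144 * energy α hα u := by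
  have h1 := abs_sub_basePoint_le hα hu x
  have h2 := abs_sub_basePoint_le hα hu y
  rw [abs_sub_comm] at h2
  have h3 := abs_sub_le (u x) (u (basePoint hα)) (u y)
  have h4 : |u x - u y| ≤ 12 * √(energy α hα u) := by linarith
  calc |u x - u y| ^ 2 ≤ (12 * √(energy α hα u)) ^ 2 := by gcongr
    _ = 144 * energy α hα u := by
      rw [mul_pow, Real.sq_sqrt (energy_nonneg hα hu)]
      norm_num

/-! ### Functions that are constant on cells -/

theorem dirichlet_const_self (c : ℝ) : dirichlet (fun _ => c) (fun _ => c) = 0 := by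
  simp [dirichlet]

/-- The function is constant on each cell of level `n`. -/
def ConstOnCells (α : ℝ) (n : ℕ) (g : Plane → ℝ) : Prop :=
  ∀ w : Fin n → Fin 3, ∀ x ∈ tri, ∀ y ∈ tri, g (wordMap α n w x) = g (wordMap α n w y)

theorem ConstOnCells.succ (hα : α ∈ Ioo (0 : ℝ) (1 / 3)) {n : ℕ} {g : Plane → ℝ}
    (hg : ConstOnCells α n g) : ConstOnCells α (n + 1) g := by
  intro w x hx y hy
  rw [← Fin.snoc_init_self w, wordMap_snoc]
  exact hg _ _ (G_sym_mem_tri hα _ hx) _ (G_sym_mem_tri hα _ hy)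

theorem ConstOnCells.discreteEnergy_eq_zero {n : ℕ} {g : Plane → ℝ} (hg : ConstOnCells α n g) :
    discreteEnergy α n g = 0 :=
  Finset.sum_eq_zero fun w _ => Finset.sum_eq_zero fun i _ => by
    rw [hg w _ (vertex_mem_tri _) _ (vertex_mem_tri _), sub_self, sq, mul_zero]

theorem ConstOnCells.continuousEnergy_eq_zero (hα : α ∈ Ioo (0 : ℝ) (1 / 3)) {n : ℕ}
    {g : Plane → ℝ} (hg : ConstOnCells α n g) : continuousEnergy α n g = 0 := by
  rw [← continuousForm_self]
  refine Finset.sum_eq_zero fun w _ => Finset.sum_eq_zero fun i _ => ?_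
  have h : EqOn (g ∘ segParam α n w i) (fun _ => g (wordMap α n w (p (sym 0)))) (Icc 0 1) := by
    intro t ht
    simp only [Function.comp_apply, segParam_eq]
    exact hg w _ (seg_mem_tri hα i ht) _ (vertex_mem_tri 0)
  rw [dirichlet_congr h h, dirichlet_const_self]

/-- From level `n` on, discrete terms vanish and every new segment lies in a cell, where the
function is constant. -/
theorem ConstOnCells.levelEnergy_eq (hα : α ∈ Ioo (0 : ℝ) (1 / 3)) {n : ℕ} {g : Plane → ℝ}
    (hg : ConstOnCells α n g) {m : ℕ} (hm : n ≤ m) :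
    ConstOnCells α m g ∧ levelEnergy α m g = levelEnergy α n g := by
  induction m, hm using Nat.le_induction with
  | base => exact ⟨hg, rfl⟩
  | succ m hm ih =>
    refine ⟨ih.1.succ hα, ?_⟩
    rw [← ih.2, levelEnergy, levelEnergy, Finset.sum_range_succ, ih.1.discreteEnergy_eq_zero,
      (ih.1.succ hα).discreteEnergy_eq_zero, ih.1.continuousEnergy_eq_zero hα]
    ring

theorem finiteEnergy_of_lipschitzWith (hα : α ∈ Ioo (0 : ℝ) (1 / 3)) {C : NNReal} {g : Plane → ℝ}
    (hg : LipschitzWith C g) {n : ℕ} (hn : ConstOnCells α n g) : FiniteEnergy α g := by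
  have hd : ∀ n, InLevelDomain α n g := fun n m _ w i =>
    isH1_of_lipschitzWith (hg.comp (lipschitzWith_lineMap _ _))
  refine ⟨hd, levelEnergy α n g, ?_⟩
  rintro _ ⟨m, rfl⟩
  rcases le_total m n with h | h
  · exact monotone_levelEnergy hα hd h
  · exact (hn.levelEnergy_eq hα h).2.le

theorem restrict_mem_F (hα : α ∈ Ioo (0 : ℝ) (1 / 3)) {C : NNReal} {g : Plane → ℝ}
    (hg : LipschitzWith C g) {n : ℕ} (hn : ConstOnCells α n g) :
    (fun x : K α hα => g x) ∈ F α hα := by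
  rw [mem_F_iff]
  refine ⟨hg.continuous.comp continuous_subtype_val,
    (finiteEnergy_of_lipschitzWith hα hg hn).congr fun x hx => ?_⟩
  rw [zeroExt_of_mem _ (VStar_subset_K hα hx)]

theorem const_mem_F (hα : α ∈ Ioo (0 : ℝ) (1 / 3)) (c : ℝ) : (fun _ => c) ∈ F α hα :=
  restrict_mem_F hα (g := fun _ => c) (LipschitzWith.const c) (n := 0) fun _ _ _ _ _ => rfl

theorem energy_const (hα : α ∈ Ioo (0 : ℝ) (1 / 3)) (c : ℝ) : energy α hα (fun _ => c) = 0 := by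
  refine tendsto_nhds_unique (tendsto_energy hα (const_mem_F hα c)) ?_
  have h0 : ConstOnCells α 0 (fun _ => c) := fun _ _ _ _ _ => rfl
  refine tendsto_const_nhds.congr fun n => ?_
  rw [levelEnergy_congr n (g := fun _ => c) fun x hx => zeroExt_of_mem _ (VStar_subset_K hα hx),
    (h0.levelEnergy_eq hα n.zero_le).2, levelEnergy, h0.discreteEnergy_eq_zero]
  simp

theorem exists_cell_small (hα : α ∈ Ioo (0 : ℝ) (1 / 3)) {ε : ℝ} (hε : 0 < ε) :
    ∃ n : ℕ, ∀ w : Fin n → Fin 3, ∀ x ∈ wordMap α n w '' tri, ∀ y ∈ wordMap α n w '' tri,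
      dist x y < ε := by
  have h0 : 0 ≤ (1 - α) / 2 := by linarith [hα.2]
  have h1 : (1 - α) / 2 < 1 := by linarith [hα.1]
  obtain ⟨n, hn⟩ := exists_pow_lt_of_lt_one (show 0 < ε / 4 by positivity) h1
  refine ⟨n, ?_⟩
  rintro w _ ⟨x, hx, rfl⟩ _ ⟨y, hy, rfl⟩
  rw [dist_wordMap hα]
  have := mul_le_mul_of_nonneg_left (dist_le_of_mem_tri hx hy) (pow_nonneg h0 n)
  linarith

theorem isCompact_cell (hα : α ∈ Ioo (0 : ℝ) (1 / 3)) (n : ℕ) (w : Fin n → Fin 3) :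
    IsCompact (wordMap α n w '' tri) :=
  isCompact_tri.of_isClosed_subset (isClosed_cell hα n w)
    (image_subset_iff.2 fun _ hx => wordMap_mem_tri hα n w hx)

/-- Two disjoint compact sets that together contain all cells of level `n`, each cell in one of
them, are separated by a function of finite energy. -/
theorem exists_separating (hα : α ∈ Ioo (0 : ℝ) (1 / 3)) {n : ℕ} {P Q : Set Plane}
    (hP : IsCompact P) (hQ : IsCompact Q) (hPQ : Disjoint P Q) {x y : K α hα} (hx : (x : Plane) ∈ P)
    (hy : (y : Plane) ∈ Q)
    (hc : ∀ w : Fin n → Fin 3, wordMap α n w '' tri ⊆ P ∨ wordMap α n w '' tri ⊆ Q) :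
    ∃ u ∈ F α hα, u x ≠ u y := by
  obtain ⟨q, hq, hmin⟩ := hQ.exists_isMinOn ⟨_, hy⟩
    (Metric.continuous_infDist_pt P).continuousOn
  have hδ : 0 < Metric.infDist q P := (hP.isClosed.notMem_iff_infDist_pos ⟨_, hx⟩).1 fun h =>
    disjoint_left.1 hPQ h hq
  -- The distance to `P`, truncated at the gap between `P` and `Q`: it is 1-Lipschitz, zero on `P`
  -- and constant on `Q`.
  set g : Plane → ℝ := fun z => min (Metric.infDist z P) (Metric.infDist q P) with hg
  have hgP : ∀ z ∈ P, g z = 0 := fun z hz => by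
    rw [hg]
    simp only [Metric.infDist_zero_of_mem hz]
    exact min_eq_left hδ.le
  have hgQ : ∀ z ∈ Q, g z = Metric.infDist q P := fun z hz => min_eq_right (hmin hz)
  refine ⟨_, restrict_mem_F hα (g := g) (C := 1)
    ((Metric.lipschitz_infDist_pt P).min_const _) (n := n) ?_, ?_⟩
  · intro w a ha b hb
    rcases hc w with h | h
    · rw [hgP _ (h ⟨a, ha, rfl⟩), hgP _ (h ⟨b, hb, rfl⟩)]
    · rw [hgQ _ (h ⟨a, ha, rfl⟩), hgQ _ (h ⟨b, hb, rfl⟩)]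
  · simp only [hgP _ hx, hgQ _ hy]
    exact hδ.ne

/-- Choose a level whose cells have diameter below `dist x y`. Then `P` is the cell of `x`, or `{x}`
if there is none, and `Q` consists of `y` and all remaining cells. -/
theorem F_separates (hα : α ∈ Ioo (0 : ℝ) (1 / 3)) (x y : K α hα) (hxy : x ≠ y) :
    ∃ u ∈ F α hα, u x ≠ u y := by
  obtain ⟨n, hn⟩ := exists_cell_small hα (dist_pos.2 (Subtype.coe_injective.ne hxy))
  by_cases hx : ∃ w : Fin n → Fin 3, (x : Plane) ∈ wordMap α n w '' tri
  · obtain ⟨w, hw⟩ := hx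
    refine exists_separating hα (n := n) (P := wordMap α n w '' tri)
      (Q := insert (y : Plane) (⋃ w' : {w' : Fin n → Fin 3 // w' ≠ w}, wordMap α n w' '' tri))
      (isCompact_cell hα n w)
      ((isCompact_iUnion fun w' : {w' // w' ≠ w} => isCompact_cell hα n w'.1).insert _)
      ?_ hw (mem_insert _ _) fun w' => ?_
    · rw [disjoint_left]
      intro z hz hz'
      rcases hz' with rfl | hz'
      · exact lt_irrefl _ (hn w _ hw _ hz)
      · obtain ⟨⟨w', hne⟩, b, hb, e⟩ := mem_iUnion.1 hz'
        obtain ⟨a, ha, rfl⟩ := hz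
        exact hne (eq_of_wordMap_eq hα n w' w hb ha e)
    · by_cases h : w' = w
      · left
        rw [h]
      · right
        exact (subset_iUnion (fun w' : {w' : Fin n → Fin 3 // w' ≠ w} =>
          wordMap α n w' '' tri) ⟨w', h⟩).trans (subset_insert _ _)
  · refine exists_separating hα (n := n) (P := {(x : Plane)})
      (Q := insert (y : Plane) (⋃ w' : Fin n → Fin 3, wordMap α n w' '' tri))
      isCompact_singleton ((isCompact_iUnion fun w' => isCompact_cell hα n w').insert _)
      ?_ rfl (mem_insert _ _) fun w' => ?_
    · rw [disjoint_singleton_left]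
      rintro (h | h)
      · exact hxy (Subtype.ext h)
      · exact hx (mem_iUnion.1 h)
    · right
      exact (subset_iUnion (fun w' : Fin n → Fin 3 => wordMap α n w' '' tri) w').trans
        (subset_insert _ _)

/-! ### The Markov property -/

theorem levelEnergy_comp_left_le (hα : α ∈ Ioo (0 : ℝ) (1 / 3)) {n : ℕ} {f : Plane → ℝ}
    (hf : InLevelDomain α n f) {φ : ℝ → ℝ} (hφ : LipschitzWith 1 φ) :
    levelEnergy α n (φ ∘ f) ≤ levelEnergy α n f := by
  refine add_le_add (mul_le_mul_of_nonneg_left ?_ (inv_nonneg.2 (rhoD_pos hα n).le))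
    (Finset.sum_le_sum fun m hm => mul_le_mul_of_nonneg_left ?_ (inv_nonneg.2 (rhoC_pos hα m).le))
  · refine Finset.sum_le_sum fun w _ => Finset.sum_le_sum fun i _ => ?_
    rw [sq_le_sq]
    simpa [Real.dist_eq] using hφ.dist_le_mul (f (wordMap α n w (p (sym (i + 1)))))
      (f (wordMap α n w (p (sym (i + 2)))))
  · rw [← continuousForm_self, ← continuousForm_self]
    exact Finset.sum_le_sum fun w _ => Finset.sum_le_sum fun i _ =>
      dirichlet_comp_left_le (hf m (Finset.mem_range.1 hm) w i) hφ

theorem F_comp_left (hα : α ∈ Ioo (0 : ℝ) (1 / 3)) {u : K α hα → ℝ} (hu : u ∈ F α hα) {φ : ℝ → ℝ}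
    (hφ : LipschitzWith 1 φ) :
    φ ∘ u ∈ F α hα ∧ energy α hα (φ ∘ u) ≤ energy α hα u := by
  have hu' := (mem_F_iff hα u).1 hu
  have heq : EqOn (φ ∘ zeroExt u) (zeroExt (φ ∘ u)) (VStar α) := fun x hx => by
    rw [zeroExt_of_mem _ (VStar_subset_K hα hx), Function.comp_apply, Function.comp_apply,
      zeroExt_of_mem _ (VStar_subset_K hα hx)]
  have hle : ∀ n, levelEnergy α n (zeroExt (φ ∘ u)) ≤ levelEnergy α n (zeroExt u) := fun n => by
    rw [← levelEnergy_congr n heq]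
    exact levelEnergy_comp_left_le hα (hu'.2.1 n) hφ
  have hdom : ∀ n, InLevelDomain α n (φ ∘ zeroExt u) := fun n m hm w i =>
    IsH1.comp_left (f := zeroExt u ∘ segParam α m w i) (hu'.2.1 n m hm w i) hφ
  have hmem : φ ∘ u ∈ F α hα := by
    refine (mem_F_iff hα _).2 ⟨hφ.continuous.comp hu'.1, fun n => (hdom n).congr heq,
      energy α hα u, ?_⟩
    rintro _ ⟨n, rfl⟩
    exact (hle n).trans (levelEnergy_le_energy hα hu n)
  exact ⟨hmem, le_of_tendsto_of_tendsto' (tendsto_energy hα hmem) (tendsto_energy hα hu) hle⟩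

theorem lipschitzWith_clamp : LipschitzWith 1 fun r : ℝ => min (max 0 r) 1 :=
  (LipschitzWith.id.const_max 0).min_const 1

/-! ### Completeness -/

theorem tendsto_levelEnergy_zero {f : ℕ → Plane → ℝ} {g : Plane → ℝ} (n : ℕ)
    (hd : ∀ x ∈ VStar α, ∀ y ∈ VStar α, Tendsto (fun k => f k x - f k y) atTop (𝓝 (g x - g y)))
    (hc : ∀ m < n, ∀ (w : Fin m → Fin 3) (i : Fin 3), Tendsto (fun k =>
      dirichlet (f k ∘ segParam α m w i - g ∘ segParam α m w i)
        (f k ∘ segParam α m w i - g ∘ segParam α m w i)) atTop (𝓝 0)) :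
    Tendsto (fun k => levelEnergy α n (f k - g)) atTop (𝓝 0) := by
  have h1 : Tendsto (fun k => discreteEnergy α n (f k - g)) atTop (𝓝 0) := by
    rw [← Finset.sum_const_zero (s := (Finset.univ : Finset (Fin n → Fin 3)))]
    refine tendsto_finsetSum _ fun w _ => ?_
    rw [← Finset.sum_const_zero (s := (Finset.univ : Finset (Fin 3)))]
    refine tendsto_finsetSum _ fun i _ => ?_
    have := ((hd _ (wordMap_vertex_mem_VStar n w (i + 1)) _
      (wordMap_vertex_mem_VStar n w (i + 2))).sub_const
      (g (wordMap α n w (p (sym (i + 1)))) - g (wordMap α n w (p (sym (i + 2)))))).pow 2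
    rw [sub_self, zero_pow two_ne_zero] at this
    refine this.congr fun k => ?_
    simp only [Pi.sub_apply]
    ring
  have h2 : ∀ m ∈ Finset.range n,
      Tendsto (fun k => (rhoC α m)⁻¹ * continuousEnergy α m (f k - g)) atTop (𝓝 0) := by
    intro m hm
    rw [← mul_zero (rhoC α m)⁻¹]
    refine Tendsto.const_mul _ ?_
    simp only [← continuousForm_self, continuousForm]
    rw [← Finset.sum_const_zero (s := (Finset.univ : Finset (Fin m → Fin 3)))]
    refine tendsto_finsetSum _ fun w _ => ?_
    rw [← Finset.sum_const_zero (s := (Finset.univ : Finset (Fin 3)))]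
    exact tendsto_finsetSum _ fun i _ => hc m (Finset.mem_range.1 hm) w i
  have h3 := (h1.const_mul (rhoD α n)⁻¹).add (tendsto_finsetSum _ h2)
  rwa [Finset.sum_const_zero, mul_zero, add_zero] at h3

theorem F_complete (hα : α ∈ Ioo (0 : ℝ) (1 / 3)) (s : ℕ → K α hα → ℝ) (hs : ∀ n, s n ∈ F α hα)
    (hc : ∀ ε > 0, ∃ N, ∀ m ≥ N, ∀ n ≥ N, energy α hα (s m - s n) < ε) :
    ∃ u ∈ F α hα, (∀ n, s n - u ∈ F α hα) ∧
      Tendsto (fun n => energy α hα (s n - u)) atTop (𝓝 0) := by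
  have hs' := fun n => (mem_F_iff hα (s n)).1 (hs n)
  -- The energy ignores constants; subtracting the value at `p₁` makes the sequence uniformly
  -- Cauchy.
  let v : ℕ → K α hα → ℝ := fun n x => s n x - s n (basePoint hα)
  have hv : UniformCauchySeqOn v atTop univ := by
    rw [Metric.uniformCauchySeqOn_iff]
    intro ε hε
    obtain ⟨N, hN⟩ := hc ((ε / 6) ^ 2) (by positivity)
    refine ⟨N, fun m hm n hn x _ => ?_⟩
    have h1 := abs_sub_basePoint_le hα (F_sub hα (hs m) (hs n)) x
    have h2 : √(energy α hα (s m - s n)) < ε / 6 := (Real.sqrt_lt' (by positivity)).2 (hN m hm n hn)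
    have h3 : dist (v m x) (v n x)
        = |(s m - s n) x - (s m - s n) (basePoint hα)| := by
      rw [Real.dist_eq]
      congr 1
      simp only [v, Pi.sub_apply]
      ring
    rw [h3]
    linarith
  choose u hu using fun x => cauchySeq_tendsto_of_complete (hv.cauchySeq (mem_univ x))
  have hunif : TendstoUniformly v u atTop := by
    rw [← tendstoUniformlyOn_univ]
    exact hv.tendstoUniformlyOn_of_tendsto fun x _ => hu x
  have hucont : Continuous u := hunif.continuous
    (Eventually.of_forall fun n => (hs' n).1.sub continuous_const).frequently
  have hdiff : ∀ x ∈ VStar α, ∀ y ∈ VStar α, Tendsto (fun k => zeroExt (s k) x - zeroExt (s k) y)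
      atTop (𝓝 (zeroExt u x - zeroExt u y)) := by
    intro x hx y hy
    simp only [zeroExt_of_mem _ (VStar_subset_K hα hx), zeroExt_of_mem _ (VStar_subset_K hα hy)]
    refine ((hu _).sub (hu _)).congr fun k => ?_
    simp only [v]
    ring
  have hseg : ∀ (m : ℕ) (w : Fin m → Fin 3) (i : Fin 3), IsH1 (zeroExt u ∘ segParam α m w i) ∧
      Tendsto (fun k => dirichlet
        (zeroExt (s k) ∘ segParam α m w i - zeroExt u ∘ segParam α m w i)
        (zeroExt (s k) ∘ segParam α m w i - zeroExt u ∘ segParam α m w i)) atTop (𝓝 0) := by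
    intro m w i
    refine isH1_of_tendsto (fun n => (hs' n).2.1 (m + 1) m (Nat.lt_succ_self m) w i) ?_ ?_
    · intro ε hε
      obtain ⟨N, hN⟩ := hc ε hε
      refine ⟨N, fun a ha b hb => lt_of_le_of_lt ?_ (hN a ha b hb)⟩
      have hF := F_sub hα (hs a) (hs b)
      have h1 := dirichlet_seg_le hα m (levelEnergy_le_energy hα hF (m + 1)) w i
      rw [zeroExt_sub] at h1
      refine h1.trans (mul_le_of_le_one_left (energy_nonneg hα hF) ?_)
      exact pow_le_one₀ (by positivity) (pow_le_one₀ (by norm_num) (by norm_num))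
    · intro t ht
      exact hdiff _ (segParam_mem_VStar m w i ht) _
        (segParam_mem_VStar m w i (left_mem_Icc.2 zero_le_one))
  have hudom : ∀ n, InLevelDomain α n (zeroExt u) := fun n m _ w i => (hseg m w i).1
  -- Fix the level `M`, compare `s n` with `u` through `s k`, and let `k → ∞`. The bound does not
  -- depend on `M`, so it survives the limit in the level; the factor 2 comes from
  -- `levelEnergy_add_le`.
  have hbound : ∀ ε > 0, ∃ N, ∀ n ≥ N, ∀ M,
      levelEnergy α M (zeroExt (s n - u)) ≤ 2 * ε := by
    intro ε hε
    obtain ⟨N, hN⟩ := hc ε hε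
    refine ⟨N, fun n hn M => ?_⟩
    have hlim := tendsto_levelEnergy_zero M hdiff fun m _ w i => (hseg m w i).2
    have hlim2 := (hlim.const_mul 2).const_add (2 * ε)
    rw [mul_zero, add_zero] at hlim2
    refine ge_of_tendsto hlim2 ?_
    filter_upwards [eventually_ge_atTop N] with k hk
    have e : zeroExt (s n - u) = zeroExt (s n - s k) + (zeroExt (s k) - zeroExt u) := by
      rw [zeroExt_sub, zeroExt_sub]
      abel
    have hF := F_sub hα (hs n) (hs k)
    have h1 := levelEnergy_add_le hα (((mem_F_iff hα _).1 hF).2.1 M)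
      (((hs' k).2.1 M).sub (hudom M))
    have h2 := levelEnergy_le_energy hα hF M
    have h3 := hN n hn k hk
    rw [e]
    linarith
  have huF : u ∈ F α hα := by
    obtain ⟨N, hN⟩ := hbound 1 one_pos
    have h1 : s N - u ∈ F α hα := by
      rw [mem_F_iff]
      refine ⟨(hs' N).1.sub hucont, fun n => ?_, 2 * 1, ?_⟩
      · rw [zeroExt_sub]
        exact ((hs' N).2.1 n).sub (hudom n)
      · rintro _ ⟨M, rfl⟩
        exact hN N le_rfl M
    -- `u = s N - (s N - u)` with both terms in `ℱ`.
    simpa using F_sub hα (hs N) h1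
  have hsu : ∀ n, s n - u ∈ F α hα := fun n => F_sub hα (hs n) huF
  refine ⟨u, huF, hsu, ?_⟩
  rw [Metric.tendsto_atTop]
  intro ε hε
  obtain ⟨N, hN⟩ := hbound (ε / 4) (by positivity)
  refine ⟨N, fun n hn => ?_⟩
  rw [Real.dist_0_eq_abs, abs_of_nonneg (energy_nonneg hα (hsu n))]
  have : energy α hα (s n - u) ≤ 2 * (ε / 4) :=
    le_of_tendsto' (tendsto_energy hα (hsu n)) (hN n hn)
  linarith

theorem isResistanceForm (hα : α ∈ Ioo (0 : ℝ) (1 / 3)) :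
    IsResistanceForm (F α hα) (form α hα) where
  const_mem := const_mem_F hα
  add_mem _ hu _ hv := F_add hα hu hv
  smul_mem c _ hu := F_smul hα c hu
  symm u hu v hv := by
    refine tendsto_nhds_unique (tendsto_form hα hu hv) ?_
    simp only [levelForm_comm _ (zeroExt u)]
    exact tendsto_form hα hv hu
  add_left u hu v hv w hw := by
    refine tendsto_nhds_unique (tendsto_form hα (F_add hα hu hv) hw) ?_
    refine ((tendsto_form hα hu hw).add (tendsto_form hα hv hw)).congr fun n => ?_
    rw [zeroExt_add, levelForm_add_left (((mem_F_iff hα u).1 hu).2.1 n)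
      (((mem_F_iff hα v).1 hv).2.1 n) (((mem_F_iff hα w).1 hw).2.1 n)]
  smul_left c u hu v hv := by
    refine tendsto_nhds_unique (tendsto_form hα (F_smul hα c hu) hv) ?_
    refine ((tendsto_form hα hu hv).const_mul c).congr fun n => ?_
    rw [zeroExt_smul, levelForm_smul_left]
  nonneg u hu := by
    rw [form_self hα hu]
    exact energy_nonneg hα hu
  eq_zero_iff u hu := by
    rw [form_self hα hu]
    constructor
    · intro h
      refine ⟨u (basePoint hα), funext fun x => ?_⟩
      have := abs_sub_basePoint_le hα hu x
      rw [h, Real.sqrt_zero, mul_zero] at this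
      exact sub_eq_zero.1 (abs_nonpos_iff.1 this)
    · rintro ⟨c, rfl⟩
      exact energy_const hα c
  complete s hs hc := by
    obtain ⟨u, hu, hsu, h⟩ := F_complete hα s hs fun ε hε => by
      obtain ⟨N, hN⟩ := hc ε hε
      refine ⟨N, fun m hm n hn => ?_⟩
      rw [← form_self hα (F_sub hα (hs m) (hs n))]
      exact hN m hm n hn
    refine ⟨u, hu, h.congr fun n => (form_self hα (hsu n)).symm⟩
  separates := F_separates hα
  resistance_finite x y := by
    refine ⟨144, ?_⟩
    rintro _ ⟨u, hu, hpos, rfl⟩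
    rw [div_le_iff₀ hpos, form_self hα hu]
    exact sq_abs_sub_le hα hu x y
  markov u hu := by
    obtain ⟨h1, h2⟩ := F_comp_left hα hu lipschitzWith_clamp
    refine ⟨h1, ?_⟩
    rw [form_self hα hu]
    exact (form_self hα h1).trans_le h2

end Hanoi

end

theorem mainTheorem3 (α : ℝ) (hα : α ∈ Set.Ioo (0 : ℝ) (1 / 3)) :
    -- `V_*` is a dense subset of `K_α`
    Hanoi.VStar α ⊆ Hanoi.K α hα ∧ Hanoi.K α hα ⊆ closure (Hanoi.VStar α) ∧
    -- the level energies increase, so that their limit exists in `[0, ∞]`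
    (∀ v : Hanoi.VStar α → ℝ, (∀ n, Hanoi.InLevelDomain α n (Hanoi.zeroExt v)) →
      Monotone fun n => Hanoi.levelEnergy α n (Hanoi.zeroExt v)) ∧
    -- every element of `𝒟_*` extends continuously to `K_α`
    (∀ v ∈ Hanoi.DStar α, Continuous (Hanoi.extendToK α hα v) ∧
      ∀ (x : Hanoi.Plane) (hx : x ∈ Hanoi.VStar α) (hxK : x ∈ Hanoi.K α hα),
        Hanoi.extendToK α hα v ⟨x, hxK⟩ = v ⟨x, hx⟩) ∧
    -- the energy is an honest limit on `ℱ`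
    (∀ u ∈ Hanoi.F α hα, Filter.Tendsto
      (fun n => Hanoi.levelEnergy α n (Hanoi.zeroExt u)) Filter.atTop
        (nhds (Hanoi.energy α hα u)) ∧ Hanoi.form α hα u u = Hanoi.energy α hα u) ∧
    -- the pair is a resistance form
    Hanoi.IsResistanceForm (Hanoi.F α hα) (Hanoi.form α hα) ∧
    -- `ℱ` consists of the continuous functions whose level energies stay bounded
    (∀ u : Hanoi.K α hα → ℝ, u ∈ Hanoi.F α hα ↔
      Continuous u ∧ (∀ n, Hanoi.InLevelDomain α n (Hanoi.zeroExt u)) ∧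
        BddAbove (Set.range fun n => Hanoi.levelEnergy α n (Hanoi.zeroExt u))) ∧
    -- `ℱ ⊆ C(K_α)`
    (∀ u ∈ Hanoi.F α hα, Continuous u) :=
  ⟨Hanoi.VStar_subset_K hα, Hanoi.K_subset_closure_VStar hα,
    fun _ hv => Hanoi.monotone_levelEnergy hα hv,
    fun _ hv => ⟨Hanoi.continuous_extendToK hα hv,
      fun _ hx hxK => Hanoi.extendToK_of_mem hα hv hx hxK⟩,
    fun _ hu => ⟨Hanoi.tendsto_energy hα hu, Hanoi.form_self hα hu⟩,
    Hanoi.isResistanceForm hα, Hanoi.mem_F_iff hα,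
    fun u hu => ((Hanoi.mem_F_iff hα u).1 hu).1⟩
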